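/- Let $k,m,n$ be natural numbers with $k$ and $m$ coprime, and let $M_d$ denote the $d\times d$ complex matrices. Let $A=\sum_{i=1}^n A_i\otimes B_i\in M_k\otimes M_m\simeq M_{km}$ (Kronecker product, $A_i\in M_k$, $B_i\in M_m$) be a positive semidefinite Hermitian matrix. Define the linear maps $G_A:M_k\to M_m$, $G_A(X)=\sum_{i=1}^n \mathrm{tr}(A_iX)\,B_i$, and $F_A:M_m\to M_k$, $F_A(X)=\sum_{i=1}^n \mathrm{tr}(B_iX)\,A_i$, and assume that $G_A(\mathrm{Id})\in M_m$ and $F_A(\mathrm{Id})\in M_k$ are positive definite Hermitian matrices. Then the following are equivalent. 1. ($A$ can be put in the filter normal form.) There are invertible matrices $X'\in M_k$, $Y'\in M_m$ and matrices $C_1,\dots,C_n\in M_k$, $D_1,\dots,D_n\in M_m$ such that $$(X'\otimes Y')A(X'\otimes Y')^*=\sum_{i=1}^n C_i\otimes D_i,\qquad C_1=\tfrac{\mathrm{Id}}{\sqrt k},\quad D_1=\tfrac{\mathrm{Id}}{\sqrt m},$$ and $\mathrm{tr}(C_iC_j)=\mathrm{tr}(D_iD_j)=0$ for all $i\neq j$.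 2. ($G_A$ has support.) For every orthonormal basis $\{v_1,\dots,v_k\}$ of $\mathbb C^k$ and every orthonormal basis $\{w_1,\dots,w_m\}$ of $\mathbb C^m$, the matrix $R=\big(\mathrm{tr}(G_A(v_i\overline{v}_i^{\,t})\,w_j\overline{w}_j^{\,t})\big)_{i,j}\in M_{k\times m}$ has support. Here a square matrix $S=(s_{ij})\in M_N$ has support if $\prod_{i=1}^N s_{i\sigma(i)}\neq 0$ for some permutation $\sigma\in S_N$, and $R\in M_{k\times m}$ has support if the square matrix $R\otimes 1_{m\times k}\in M_{km}$ has support, where $1_{m\times k}$ is the $m\times k$ matrix with all entries equal to $1$. -/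

import Mathlib

open scoped ComplexOrder Kronecker

namespace FilterNormalForm

/-- A square complex matrix has support if some permutation `σ` satisfies
`∏ i, a i (σ i) ≠ 0`. -/
def SquareHasSupport {N : ℕ} (A : Matrix (Fin N) (Fin N) ℂ) : Prop :=
  ∃ σ : Equiv.Perm (Fin N), ∏ i, A i (σ i) ≠ 0

/-- The Kronecker product `A ⊗ 1_{m × k}` of `A : M_{k × m}` with the all-ones `m × k` matrix, as a
square matrix of order `k * m` (rows and columns in the usual lexicographic order). -/
def kroneckerOnes {k m : ℕ} (A : Matrix (Fin k) (Fin m) ℂ) :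
    Matrix (Fin (k * m)) (Fin (k * m)) ℂ :=
  Matrix.reindex finProdFinEquiv (finProdFinEquiv.trans (finCongr (Nat.mul_comm m k)))
    (A ⊗ₖ (Matrix.of fun (_ : Fin m) (_ : Fin k) => (1 : ℂ)))

/-- A rectangular matrix `A : M_{k × m}` has support if the square matrix `A ⊗ 1_{m × k}` does. -/
def RectHasSupport {k m : ℕ} (A : Matrix (Fin k) (Fin m) ℂ) : Prop :=
  SquareHasSupport (kroneckerOnes A)

/-- The rank-one matrix `v v̄ᵗ`. -/
def rankOne {d : ℕ} (v : EuclideanSpace ℂ (Fin d)) : Matrix (Fin d) (Fin d) ℂ :=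
  Matrix.of fun a b => v a * star (v b)

/-- A linear map `T : M_k → M_m` has support if for all orthonormal bases `v` of `ℂ^k` and `w` of
`ℂ^m`, the `k × m` matrix with entries `tr (T(v_i v̄_iᵗ) w_j w̄_jᵗ)` has support. -/
def MapHasSupport {k m : ℕ}
    (T : Matrix (Fin k) (Fin k) ℂ →ₗ[ℂ] Matrix (Fin m) (Fin m) ℂ) : Prop :=
  ∀ (v : OrthonormalBasis (Fin k) ℂ (EuclideanSpace ℂ (Fin k)))
    (w : OrthonormalBasis (Fin m) ℂ (EuclideanSpace ℂ (Fin m))),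
    RectHasSupport (Matrix.of fun (i : Fin k) (j : Fin m) =>
      Matrix.trace (T (rankOne (v i)) * rankOne (w j)))

/-- The linear map `X ↦ ∑ i, tr (A_i X) B_i`.  For `A = ∑ i, A_i ⊗ B_i`, the map `G_A : M_k → M_m`
is `sliceMap A B` and the map `F_A : M_m → M_k` is `sliceMap B A`. -/
def sliceMap {k m n : ℕ} (A : Fin n → Matrix (Fin k) (Fin k) ℂ)
    (B : Fin n → Matrix (Fin m) (Fin m) ℂ) :
    Matrix (Fin k) (Fin k) ℂ →ₗ[ℂ] Matrix (Fin m) (Fin m) ℂ where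
  toFun X := ∑ i, Matrix.trace (A i * X) • B i
  map_add' X Y := by
    simp [Matrix.mul_add, add_smul, Finset.sum_add_distrib]
  map_smul' c X := by
    simp [mul_smul, Finset.smul_sum]

end FilterNormalForm

namespace FilterNormalForm

open Matrix Finset

/-! ### Support of rectangular matrices -/

/-! Both conditions are compared with a third: some `(X ⊗ Y) A (X ⊗ Y)ᴴ` has scalar marginals,
meaning that its two slice maps send the identity to scalar multiples of the identity.

Normal form implies support. Since `C₁` and `D₁` are multiples of the identity, the other `Cᵢ` and
`Dᵢ` are traceless, so the marginals are scalar. If a diagonal block `S × T` of a local conjugate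
vanishes, pairing the matrix with the product of the two complementary orthogonal projections gives
`m|S| + k|T| ≤ mk` (`card_add_card_le_of_balanced`). This is Hall's condition for a perfect matching
of `R ⊗ 1`.

Support implies normal form. Minimise `tr (A (Q ⊗ R))` over positive definite `Q`, `R` of
determinant one, written `U diag(eᵃ) Uᴴ` and `V diag(eᵇ) Vᴴ`. On a sublevel set a matching bounds `a
i + b j` from above along its edges; coprimality of `k` and `m` turns this into a bound on `a` and
`b` (`exists_bound_of_equiv`), and compactness of the unitary groups makes it uniform. Stationarity
at a minimiser gives scalar marginals (`eq_smul_one_of_trace_le`). Diagonalising `F ∘ G` on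
traceless Hermitian matrices then yields the orthogonal decomposition with the identity as a
separate term (`exists_normal_form`). -/

theorem rectHasSupport_iff {k m : ℕ} (R : Matrix (Fin k) (Fin m) ℂ) :
    RectHasSupport R ↔
      ∃ e : Fin k × Fin m ≃ Fin m × Fin k, ∀ x, R x.1 (e x).1 ≠ 0 := by
  set f : Fin k × Fin m ≃ Fin (k * m) := finProdFinEquiv
  set g : Fin m × Fin k ≃ Fin (k * m) :=
    finProdFinEquiv.trans (finCongr (Nat.mul_comm m k))
  have key : ∀ i j, kroneckerOnes R i j = R (f.symm i).1 (g.symm j).1 := by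
    intro i j
    simp [kroneckerOnes, f, g, Matrix.kroneckerMap_apply]
  constructor
  · rintro ⟨σ, hσ⟩
    refine ⟨(f.trans σ).trans g.symm, fun x => ?_⟩
    have := Finset.prod_ne_zero_iff.1 hσ (f x) (mem_univ _)
    simpa [key] using this
  · rintro ⟨e, he⟩
    refine ⟨(f.symm.trans e).trans g, Finset.prod_ne_zero_iff.2 fun i _ => ?_⟩
    simpa [key] using he (f.symm i)

/-- Hall's theorem for the blown-up graph. A set of rows may be enlarged to all `m` copies of each
index it meets without changing its neighbours, so only sets `S × Fin m` need testing. -/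
theorem exists_equiv_of_card_le {k m : ℕ} (r : Fin k → Fin m → Prop)
    [∀ i, DecidablePred (r i)]
    (h : ∀ S : Finset (Fin k), m * #S ≤ k * #(S.biUnion fun i => univ.filter (r i))) :
    ∃ e : Fin k × Fin m ≃ Fin m × Fin k, ∀ x, r x.1 (e x).1 := by
  classical
  obtain ⟨f, hf, hfr⟩ := (Finset.all_card_le_biUnion_card_iff_exists_injective
    (fun x : Fin k × Fin m => (univ.filter (r x.1)) ×ˢ (univ : Finset (Fin k)))).1 (by
      intro F
      have h1 : F ⊆ (F.image Prod.fst) ×ˢ (univ : Finset (Fin m)) := by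
        intro x hx
        simp only [mem_product, mem_univ, and_true]
        exact mem_image_of_mem _ hx
      have h2 : (F.biUnion fun x => (univ.filter (r x.1)) ×ˢ (univ : Finset (Fin k))) =
          ((F.image Prod.fst).biUnion fun i => univ.filter (r i)) ×ˢ univ := by
        ext x
        simp
      have h3 := card_le_card h1
      rw [card_product, card_univ, Fintype.card_fin] at h3
      rw [h2, card_product, card_univ, Fintype.card_fin]
      have := h (F.image Prod.fst)
      nlinarith)
  have hb : Function.Bijective f := by
    rw [Fintype.bijective_iff_injective_and_card]
    exact ⟨hf, by simp [mul_comm]⟩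
  refine ⟨Equiv.ofBijective f hb, fun x => ?_⟩
  simpa using hfr x

/-- The matching carries the level set `a = a 0` times `Fin m` onto the level set `b = -a 0` times
`Fin k`. Hence `k` divides `m * #S`, and by coprimality `#S`; so `S` is everything and `a` is
constant. -/
theorem eq_zero_of_add_equiv_eq_zero {k m : ℕ} (hk : 0 < k) (hkm : Nat.Coprime k m)
    (e : Fin k × Fin m ≃ Fin m × Fin k) (a : Fin k → ℝ) (b : Fin m → ℝ)
    (h : ∀ x, a x.1 + b (e x).1 = 0) (ha : ∑ i, a i = 0) : a = 0 ∧ b = 0 := by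
  classical
  have : NeZero k := ⟨hk.ne'⟩
  have hconst : ∀ i, a i = a 0 := by
    set S : Finset (Fin k) := univ.filter fun i => a i = a 0
    set T : Finset (Fin m) := univ.filter fun j => b j = - a 0
    have hcard : #(S ×ˢ (univ : Finset (Fin m))) = #(T ×ˢ (univ : Finset (Fin k))) := by
      refine card_bijective e e.bijective fun x => ?_
      have := h x
      simp only [mem_product, mem_univ, and_true, S, T, mem_filter, true_and]
      constructor <;> intro h' <;> linarith
    simp only [card_product, card_univ, Fintype.card_fin] at hcard
    have hdvd : k ∣ #S := hkm.dvd_of_dvd_mul_right ⟨#T, by rw [hcard, mul_comm]⟩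
    have hpos : 0 < #S := card_pos.2 ⟨0, by simp [S]⟩
    have hS : S = univ := by
      refine eq_univ_of_card _ (le_antisymm (card_le_univ _) ?_)
      rw [Fintype.card_fin]
      exact Nat.le_of_dvd hpos hdvd
    intro i
    have : i ∈ S := hS ▸ mem_univ i
    simpa [S] using this
  have ha0 : a 0 = 0 := by
    rw [sum_congr rfl fun i _ => hconst i] at ha
    simpa [hk.ne'] using ha
  refine ⟨funext fun i => (hconst i).trans ha0, funext fun j => ?_⟩
  have := h (e.symm (j, 0))
  rw [hconst, ha0] at this
  simpa using this

/-- If `a` and `b` have zero sum, upper bounds for `a i + b j` along a perfect matching of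
`R ⊗ 1` bound `a` and `b`. -/
theorem exists_bound_of_equiv {k m : ℕ} (hk : 0 < k) (hkm : Nat.Coprime k m)
    (e : Fin k × Fin m ≃ Fin m × Fin k) (c : ℝ) :
    ∃ K : ℝ, ∀ (a : Fin k → ℝ) (b : Fin m → ℝ), ∑ i, a i = 0 → ∑ j, b j = 0 →
      (∀ x, a x.1 + b (e x).1 ≤ c) → ‖(a, b)‖ ≤ K := by
  classical
  -- The extra coordinate `∑ i, p.1 i` removes the kernel direction of constant pairs `(t, -t)`.
  -- Then `L` is injective, hence antilipschitz in finite dimension.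
  let L : ((Fin k → ℝ) × (Fin m → ℝ)) →ₗ[ℝ] (Fin k × Fin m → ℝ) × ℝ :=
    { toFun := fun p => (fun x => p.1 x.1 + p.2 (e x).1, ∑ i, p.1 i)
      map_add' := by
        intro p q
        ext
        · simp; ring
        · simp [sum_add_distrib]
      map_smul' := by
        intro t p
        ext
        · simp; ring
        · simp [mul_sum] }
  have hL : LinearMap.ker L = ⊥ := by
    rw [LinearMap.ker_eq_bot']
    rintro ⟨a, b⟩ hab
    simp only [L, LinearMap.coe_mk, AddHom.coe_mk, Prod.mk_eq_zero] at hab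
    obtain ⟨h1, h2⟩ := eq_zero_of_add_equiv_eq_zero hk hkm e a b (fun x => congrFun hab.1 x) hab.2
    simp [h1, h2]
  obtain ⟨K, -, hK⟩ := LinearMap.exists_antilipschitzWith L hL
  refine ⟨K * (k * m * |c|), fun a b ha hb hab => ?_⟩
  have hbd := hK.le_mul_norm_sub (a, b) 0
  have hsum : ∑ x : Fin k × Fin m, (a x.1 + b (e x).1) = 0 := by
    rw [sum_add_distrib, Equiv.sum_comp e fun y => b y.1, Fintype.sum_prod_type,
      Fintype.sum_prod_type]
    simp [← mul_sum, ha, hb]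
  -- The terms sum to zero, so each one is minus the sum of the others; upper bounds thus give lower
  -- bounds.
  have hterm : ∀ x : Fin k × Fin m, |a x.1 + b (e x).1| ≤ k * m * |c| := by
    intro x
    have hc : (Fintype.card (Fin k × Fin m) : ℝ) = k * m := by simp
    have hx1 : (1 : ℝ) ≤ k * m := by
      rw [← hc]; exact_mod_cast Fintype.card_pos_iff.2 ⟨x⟩
    rw [abs_le]
    constructor
    · have h1 : ∑ y ∈ univ.erase x, (a y.1 + b (e y).1) ≤ ∑ y ∈ univ.erase x, |c| :=
        sum_le_sum fun y _ => (hab y).trans (le_abs_self c)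
      have h2 := add_sum_erase univ (fun y : Fin k × Fin m => a y.1 + b (e y).1) (mem_univ x)
      have h3 : ∑ y ∈ univ.erase x, |c| ≤ ∑ y : Fin k × Fin m, |c| :=
        sum_le_sum_of_subset_of_nonneg (erase_subset _ _) fun _ _ _ => abs_nonneg c
      have h4 : ∑ y : Fin k × Fin m, |c| = k * m * |c| := by simp
      linarith
    · have := (hab x).trans (le_abs_self c)
      nlinarith [abs_nonneg c]
  have hn : ‖L (a, b)‖ ≤ k * m * |c| := by
    have h0 : (0 : ℝ) ≤ k * m * |c| := by positivity
    refine max_le ((pi_norm_le_iff_of_nonneg h0).2 hterm) ?_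
    simpa [L, ha] using h0
  rw [map_zero, add_zero, norm_neg, add_zero, norm_neg] at hbd
  exact hbd.trans (mul_le_mul_of_nonneg_left hn K.2)

/-! ### Traces against Kronecker products -/

/-- The pairing depends only on the sum `A`, not on its decomposition. Together with the next
identity it makes `F_A` and `G_A` adjoint for the trace form. -/
theorem trace_sliceMap_mul {k m n : ℕ} (As : Fin n → Matrix (Fin k) (Fin k) ℂ)
    (Bs : Fin n → Matrix (Fin m) (Fin m) ℂ) (X : Matrix (Fin k) (Fin k) ℂ)
    (Y : Matrix (Fin m) (Fin m) ℂ) :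
    trace (sliceMap As Bs X * Y) = trace ((∑ i, As i ⊗ₖ Bs i) * (X ⊗ₖ Y)) := by
  simp [sliceMap, sum_mul, trace_sum, ← mul_kronecker_mul, trace_kronecker]

theorem trace_sliceMap_mul_symm {k m n : ℕ} (As : Fin n → Matrix (Fin k) (Fin k) ℂ)
    (Bs : Fin n → Matrix (Fin m) (Fin m) ℂ) (X : Matrix (Fin k) (Fin k) ℂ)
    (Y : Matrix (Fin m) (Fin m) ℂ) :
    trace (sliceMap Bs As Y * X) = trace ((∑ i, As i ⊗ₖ Bs i) * (X ⊗ₖ Y)) := by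
  simp [sliceMap, sum_mul, trace_sum, ← mul_kronecker_mul, trace_kronecker, mul_comm]

theorem sum_conj_kronecker {k m n : ℕ} (As : Fin n → Matrix (Fin k) (Fin k) ℂ)
    (Bs : Fin n → Matrix (Fin m) (Fin m) ℂ) (X : Matrix (Fin k) (Fin k) ℂ)
    (Y : Matrix (Fin m) (Fin m) ℂ) :
    (X ⊗ₖ Y) * (∑ i, As i ⊗ₖ Bs i) * (X ⊗ₖ Y)ᴴ =
      ∑ i, (X * As i * Xᴴ) ⊗ₖ (Y * Bs i * Yᴴ) := by
  simp [mul_sum, sum_mul, mul_kronecker_mul, conjTranspose_kronecker]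

theorem trace_mul_nonneg {ι : Type*} [Fintype ι] [DecidableEq ι] {A B : Matrix ι ι ℂ}
    (hA : A.PosSemidef) (hB : B.PosSemidef) : 0 ≤ trace (A * B) := by
  obtain ⟨C, rfl⟩ : ∃ C : Matrix ι ι ℂ, A = Cᴴ * C := by
    open scoped MatrixOrder in
    exact CStarAlgebra.nonneg_iff_eq_star_mul_self.1 hA.nonneg
  rw [Matrix.mul_assoc, trace_mul_comm]
  exact (hB.mul_mul_conjTranspose_same C).trace_nonneg

/-- The diagonal entries of `(U ⊗ V)ᴴ A (U ⊗ V)` are the weights of `A` along pairs of columns. -/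
theorem trace_mul_conj_diagonal {k m : ℕ} (A : Matrix (Fin k × Fin m) (Fin k × Fin m) ℂ)
    (U : Matrix (Fin k) (Fin k) ℂ) (V : Matrix (Fin m) (Fin m) ℂ) (x : Fin k → ℂ)
    (y : Fin m → ℂ) :
    trace (A * ((U * diagonal x * Uᴴ) ⊗ₖ (V * diagonal y * Vᴴ))) =
      ∑ i, ∑ j, ((U ⊗ₖ V)ᴴ * A * (U ⊗ₖ V)) (i, j) (i, j) * (x i * y j) := by
  rw [mul_kronecker_mul, mul_kronecker_mul, ← conjTranspose_kronecker, trace_mul_comm,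
    Matrix.mul_assoc, Matrix.mul_assoc, trace_mul_comm, Matrix.mul_assoc, trace_mul_comm,
    diagonal_kronecker_diagonal, ← Fintype.sum_prod_type']
  simp [trace, mul_diagonal]

/-- The matrix whose columns are the vectors of a basis. -/
def columns {d : ℕ} (v : Fin d → EuclideanSpace ℂ (Fin d)) : Matrix (Fin d) (Fin d) ℂ :=
  Matrix.of fun a i => v i a

theorem columns_conjTranspose_mul_self_apply {d : ℕ} (v : Fin d → EuclideanSpace ℂ (Fin d))
    (i j : Fin d) : ((columns v)ᴴ * columns v) i j = inner ℂ (v i) (v j) := by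
  simp [columns, mul_apply, PiLp.inner_apply, mul_comm]

theorem columns_conjTranspose_mul_self {d : ℕ}
    (v : OrthonormalBasis (Fin d) ℂ (EuclideanSpace ℂ (Fin d))) :
    (columns v)ᴴ * columns v = 1 := by
  ext i j
  rw [columns_conjTranspose_mul_self_apply, orthonormal_iff_ite.1 v.orthonormal, one_apply]

theorem exists_columns_eq {d : ℕ} {U : Matrix (Fin d) (Fin d) ℂ} (hU : Uᴴ * U = 1) :
    ∃ v : OrthonormalBasis (Fin d) ℂ (EuclideanSpace ℂ (Fin d)), columns v = U := by
  have hc : columns (fun i => WithLp.toLp 2 fun a => U a i) = U := rfl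
  have ho : Orthonormal ℂ (fun i : Fin d => (WithLp.toLp 2 fun a => U a i :
      EuclideanSpace ℂ (Fin d))) := by
    rw [orthonormal_iff_ite]
    intro i j
    have := columns_conjTranspose_mul_self_apply
      (fun i : Fin d => (WithLp.toLp 2 fun a => U a i : EuclideanSpace ℂ (Fin d))) i j
    rw [← this, hc, hU, one_apply]
  obtain ⟨b, hb⟩ := Orthonormal.exists_orthonormalBasis_extension_of_card_eq
    (s := Set.univ) (by simp) (v := fun i : Fin d => (WithLp.toLp 2 fun a => U a i :
      EuclideanSpace ℂ (Fin d))) (ho.comp _ Subtype.val_injective)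
  refine ⟨b, ?_⟩
  ext a i
  simp [columns, hb i (Set.mem_univ i)]

theorem rankOne_eq_columns {d : ℕ} (v : Fin d → EuclideanSpace ℂ (Fin d)) (i : Fin d) :
    rankOne (v i) = columns v * diagonal (Pi.single i 1) * (columns v)ᴴ := by
  ext a b
  simp [rankOne, columns, mul_apply (M := _ * _), mul_diagonal, Pi.single_apply]

theorem trace_sliceMap_rankOne {k m n : ℕ} (As : Fin n → Matrix (Fin k) (Fin k) ℂ)
    (Bs : Fin n → Matrix (Fin m) (Fin m) ℂ) (v : Fin k → EuclideanSpace ℂ (Fin k))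
    (w : Fin m → EuclideanSpace ℂ (Fin m)) (i : Fin k) (j : Fin m) :
    trace (sliceMap As Bs (rankOne (v i)) * rankOne (w j)) =
      ((columns v ⊗ₖ columns w)ᴴ * (∑ l, As l ⊗ₖ Bs l) * (columns v ⊗ₖ columns w))
        (i, j) (i, j) := by
  rw [trace_sliceMap_mul, rankOne_eq_columns, rankOne_eq_columns, trace_mul_conj_diagonal]
  simp [Pi.single_apply]

/-- `G_A` has support iff all local unitary conjugates of `A` have perfectly matched diagonals. -/
theorem mapHasSupport_sliceMap_iff {k m n : ℕ} (As : Fin n → Matrix (Fin k) (Fin k) ℂ)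
    (Bs : Fin n → Matrix (Fin m) (Fin m) ℂ) :
    MapHasSupport (sliceMap As Bs) ↔
      ∀ (U : Matrix (Fin k) (Fin k) ℂ) (V : Matrix (Fin m) (Fin m) ℂ), Uᴴ * U = 1 → Vᴴ * V = 1 →
        ∃ e : Fin k × Fin m ≃ Fin m × Fin k, ∀ x,
          ((U ⊗ₖ V)ᴴ * (∑ l, As l ⊗ₖ Bs l) * (U ⊗ₖ V)) (x.1, (e x).1) (x.1, (e x).1) ≠ 0 := by
  constructor
  · intro h U V hU hV
    obtain ⟨v, rfl⟩ := exists_columns_eq hU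
    obtain ⟨w, rfl⟩ := exists_columns_eq hV
    simpa only [rectHasSupport_iff, of_apply, trace_sliceMap_rankOne] using h v w
  · intro h v w
    simpa only [rectHasSupport_iff, of_apply, trace_sliceMap_rankOne] using
      h _ _ (columns_conjTranspose_mul_self v) (columns_conjTranspose_mul_self w)

/-! ### Balanced matrices have support -/

/-- The orthogonal projection onto the span of a subset of the columns of an invertible matrix. -/
theorem exists_projection {k : ℕ} {M : Matrix (Fin k) (Fin k) ℂ} (hM : IsUnit M)
    (S : Finset (Fin k)) :
    ∃ N : Matrix S S ℂ,
      let P : Matrix (Fin k) S ℂ := M.submatrix id Subtype.val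
      (1 - P * N * Pᴴ).PosSemidef ∧ trace (P * N * Pᴴ) = #S := by
  classical
  set P : Matrix (Fin k) S ℂ := M.submatrix id Subtype.val
  have hpd : (Pᴴ * P).PosDef := by
    have h1 : (Mᴴ * M).PosDef :=
      PosDef.conjTranspose_mul_self M (mulVec_injective_iff_isUnit.2 hM)
    exact h1.submatrix (e := (Subtype.val : S → Fin k)) Subtype.val_injective
  have hdet : IsUnit (Pᴴ * P).det := (isUnit_iff_isUnit_det _).1 hpd.isUnit
  -- The inverse Gram matrix makes `P * N * Pᴴ` the orthogonal projection. The factored form is kept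
  -- so that a vanishing block of the conjugated matrix can be recognised between the outer factors.
  refine ⟨(Pᴴ * P)⁻¹, ?_, ?_⟩
  · set Q := P * (Pᴴ * P)⁻¹ * Pᴴ
    have hQQ : Q * Q = Q := by
      calc Q * Q = P * (Pᴴ * P)⁻¹ * ((Pᴴ * P) * (Pᴴ * P)⁻¹) * Pᴴ := by
            simp only [Q, Matrix.mul_assoc]
        _ = Q := by rw [mul_nonsing_inv _ hdet, Matrix.mul_one]
    have hQ : Qᴴ = Q := by
      simp [Q, conjTranspose_nonsing_inv, Matrix.mul_assoc]
    have : 1 - Q = (1 - Q)ᴴ * (1 - Q) := by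
      simp [hQ, Matrix.sub_mul, Matrix.mul_sub, hQQ]
    rw [this]
    exact posSemidef_conjTranspose_mul_self _
  · rw [trace_mul_comm, ← Matrix.mul_assoc, mul_nonsing_inv _ hdet]
    simp

/-- With `p`, `q` the projections onto the columns in `S` and `T`, expand `0 ≤ tr (A ((1 - p) ⊗ (1 -
q)))`. The term in `p ⊗ q` is zero and scalar marginals evaluate the rest as `α k - α #S - β #T`. -/
theorem card_add_card_le_of_balanced {k m : ℕ}
    {A : Matrix (Fin k × Fin m) (Fin k × Fin m) ℂ} (hA : A.PosSemidef) {α β : ℝ}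
    (hα : ∀ Q : Matrix (Fin k) (Fin k) ℂ,
      trace (A * (Q ⊗ₖ (1 : Matrix (Fin m) (Fin m) ℂ))) = α * trace Q)
    (hβ : ∀ Q : Matrix (Fin m) (Fin m) ℂ,
      trace (A * ((1 : Matrix (Fin k) (Fin k) ℂ) ⊗ₖ Q)) = β * trace Q)
    {U : Matrix (Fin k) (Fin k) ℂ} {V : Matrix (Fin m) (Fin m) ℂ} (hU : IsUnit U)
    (hV : IsUnit V) (S : Finset (Fin k)) (T : Finset (Fin m))
    (h : ∀ i ∈ S, ∀ j ∈ T, ((U ⊗ₖ V)ᴴ * A * (U ⊗ₖ V)) (i, j) (i, j) = 0) :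
    α * #S + β * #T ≤ α * k := by
  classical
  obtain ⟨N, hN, hNt⟩ := exists_projection hU S
  obtain ⟨L, hL, hLt⟩ := exists_projection hV T
  set P : Matrix (Fin k) S ℂ := U.submatrix id Subtype.val
  set R : Matrix (Fin m) T ℂ := V.submatrix id Subtype.val
  have hsub : (P ⊗ₖ R)ᴴ * A * (P ⊗ₖ R) =
      ((U ⊗ₖ V)ᴴ * A * (U ⊗ₖ V)).submatrix (Prod.map Subtype.val Subtype.val)
        (Prod.map Subtype.val Subtype.val) := rfl
  -- A positive semidefinite block with zero diagonal has zero trace, hence is zero.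
  have hzero : (P ⊗ₖ R)ᴴ * A * (P ⊗ₖ R) = 0 := by
    rw [← (hA.conjTranspose_mul_mul_same (P ⊗ₖ R)).trace_eq_zero_iff, hsub]
    exact sum_eq_zero fun x _ => h _ x.1.2 _ x.2.2
  have htr : trace (A * ((P * N * Pᴴ) ⊗ₖ (R * L * Rᴴ))) = 0 := by
    rw [mul_kronecker_mul, mul_kronecker_mul, ← conjTranspose_kronecker, ← Matrix.mul_assoc,
      trace_mul_comm, ← Matrix.mul_assoc, ← Matrix.mul_assoc, hzero]
    simp
  have hnn := trace_mul_nonneg hA (hN.kronecker hL)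
  have hexp : trace (A * ((1 - P * N * Pᴴ) ⊗ₖ (1 - R * L * Rᴴ))) =
      trace (A * (1 ⊗ₖ 1)) - trace (A * ((P * N * Pᴴ) ⊗ₖ 1)) - trace (A * (1 ⊗ₖ (R * L * Rᴴ)))
        + trace (A * ((P * N * Pᴴ) ⊗ₖ (R * L * Rᴴ))) := by
    have : ((1 - P * N * Pᴴ) ⊗ₖ (1 - R * L * Rᴴ)) =
        1 ⊗ₖ 1 - (P * N * Pᴴ) ⊗ₖ 1 - 1 ⊗ₖ (R * L * Rᴴ) + (P * N * Pᴴ) ⊗ₖ (R * L * Rᴴ) := by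
      ext ⟨a, b⟩ ⟨c, d⟩
      simp only [kroneckerMap_apply, Matrix.sub_apply, Matrix.add_apply]
      ring
    rw [this, Matrix.mul_add, Matrix.mul_sub, Matrix.mul_sub, trace_add, trace_sub, trace_sub]
  rw [hexp, htr, hα, hα, hβ, hNt, hLt, trace_one, Fintype.card_fin, add_zero] at hnn
  have : (0 : ℂ) ≤ ((α * k - α * #S - β * #T : ℝ) : ℂ) := by
    push_cast
    exact hnn
  have := Complex.zero_le_real.1 this
  linarith

/-! ### Minimising the trace over local scalings of determinant one -/

theorem isCompact_unitary (d : ℕ) :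
    IsCompact {U : Matrix (Fin d) (Fin d) ℂ | Uᴴ * U = 1} := by
  have hc : IsClosed {U : Matrix (Fin d) (Fin d) ℂ | Uᴴ * U = 1} :=
    isClosed_eq (by fun_prop) continuous_const
  have hK : IsCompact (Set.univ.pi fun _ : Fin d => Set.univ.pi fun _ : Fin d =>
      Metric.closedBall (0 : ℂ) 1) :=
    isCompact_univ_pi fun _ => isCompact_univ_pi fun _ => isCompact_closedBall _ _
  refine IsCompact.of_isClosed_subset hK hc fun U hU i _ j _ => ?_
  rw [mem_closedBall_zero_iff]
  exact entry_norm_bound_of_unitary (mem_unitaryGroup_iff'.2 hU) i j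

/-- The value of the state `A` on the product of the positive definite matrices
`U diag(eᵃ) Uᴴ` and `V diag(eᵇ) Vᴴ`. -/
noncomputable def scaledTrace {k m : ℕ} (A : Matrix (Fin k × Fin m) (Fin k × Fin m) ℂ)
    (U : Matrix (Fin k) (Fin k) ℂ) (V : Matrix (Fin m) (Fin m) ℂ) (a : Fin k → ℝ)
    (b : Fin m → ℝ) : ℝ :=
  ∑ i, ∑ j, (((U ⊗ₖ V)ᴴ * A * (U ⊗ₖ V)) (i, j) (i, j)).re * (Real.exp (a i) * Real.exp (b j))

/-- The matrix `U diag(eᵃ) Uᴴ`. -/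
noncomputable def expConj {d : ℕ} (U : Matrix (Fin d) (Fin d) ℂ) (a : Fin d → ℝ) :
    Matrix (Fin d) (Fin d) ℂ :=
  U * diagonal (fun i => (Real.exp (a i) : ℂ)) * Uᴴ

theorem re_trace_mul_expConj {k m : ℕ} (A : Matrix (Fin k × Fin m) (Fin k × Fin m) ℂ)
    (U : Matrix (Fin k) (Fin k) ℂ) (V : Matrix (Fin m) (Fin m) ℂ) (a : Fin k → ℝ)
    (b : Fin m → ℝ) :
    (trace (A * (expConj U a ⊗ₖ expConj V b))).re = scaledTrace A U V a b := by
  rw [expConj, expConj, trace_mul_conj_diagonal, scaledTrace, Complex.re_sum]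
  refine sum_congr rfl fun i _ => ?_
  rw [Complex.re_sum]
  refine sum_congr rfl fun j _ => ?_
  rw [← Complex.ofReal_mul, Complex.re_mul_ofReal]

theorem isUnit_of_conjTranspose_mul_self {d : ℕ} {U : Matrix (Fin d) (Fin d) ℂ}
    (hU : Uᴴ * U = 1) : IsUnit U :=
  IsUnit.of_mul_eq_one Uᴴ (mul_eq_one_comm.1 hU)

theorem expConj_posDef {d : ℕ} {U : Matrix (Fin d) (Fin d) ℂ} (hU : Uᴴ * U = 1)
    (a : Fin d → ℝ) : (expConj U a).PosDef := by
  refine PosDef.mul_mul_conjTranspose_same (PosDef.diagonal fun i => ?_) ?_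
  · exact_mod_cast Real.exp_pos _
  · exact vecMul_injective_iff_isUnit.2 (isUnit_of_conjTranspose_mul_self hU)

theorem det_expConj {d : ℕ} {U : Matrix (Fin d) (Fin d) ℂ} (hU : Uᴴ * U = 1)
    (a : Fin d → ℝ) : (expConj U a).det = (Real.exp (∑ i, a i) : ℝ) := by
  rw [expConj, det_mul_comm, ← Matrix.mul_assoc, hU, Matrix.one_mul, det_diagonal, Real.exp_sum]
  push_cast
  rfl

theorem exists_eq_expConj {d : ℕ} {Q : Matrix (Fin d) (Fin d) ℂ} (hQ : Q.PosDef)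
    (hdet : Q.det = 1) :
    ∃ (U : Matrix (Fin d) (Fin d) ℂ) (a : Fin d → ℝ), Uᴴ * U = 1 ∧ ∑ i, a i = 0 ∧
      Q = expConj U a := by
  have hU : (hQ.1.eigenvectorUnitary : Matrix (Fin d) (Fin d) ℂ)ᴴ * hQ.1.eigenvectorUnitary = 1 :=
    mem_unitaryGroup_iff'.1 hQ.1.eigenvectorUnitary.2
  have hQ' : Q = expConj hQ.1.eigenvectorUnitary fun i => Real.log (hQ.1.eigenvalues i) := by
    conv_lhs => rw [hQ.1.spectral_theorem, Unitary.conjStarAlgAut_apply]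
    simp only [expConj, Real.exp_log (hQ.eigenvalues_pos _)]
    rfl
  refine ⟨_, _, hU, ?_, hQ'⟩
  rw [hQ', det_expConj hU] at hdet
  exact Real.exp_eq_one_iff _ |>.1 (by exact_mod_cast hdet)

theorem scaledTrace_entry_nonneg {k m : ℕ} {A : Matrix (Fin k × Fin m) (Fin k × Fin m) ℂ}
    (hA : A.PosSemidef) (U : Matrix (Fin k) (Fin k) ℂ) (V : Matrix (Fin m) (Fin m) ℂ)
    (x : Fin k × Fin m) : 0 ≤ ((U ⊗ₖ V)ᴴ * A * (U ⊗ₖ V)) x x :=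
  (hA.conjTranspose_mul_mul_same (U ⊗ₖ V)).diag_nonneg

theorem continuous_kronecker_conj_entry {k m : ℕ}
    (A : Matrix (Fin k × Fin m) (Fin k × Fin m) ℂ) (x : Fin k × Fin m) :
    Continuous fun p : Matrix (Fin k) (Fin k) ℂ × Matrix (Fin m) (Fin m) ℂ =>
      (((p.1 ⊗ₖ p.2)ᴴ * A * (p.1 ⊗ₖ p.2)) x x).re := by
  have h : Continuous fun p : Matrix (Fin k) (Fin k) ℂ × Matrix (Fin m) (Fin m) ℂ =>
      p.1 ⊗ₖ p.2 := by
    refine continuous_matrix fun y z => ?_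
    simp only [kroneckerMap_apply]
    exact (continuous_fst.matrix_elem _ _).mul (continuous_snd.matrix_elem _ _)
  exact Complex.continuous_re.comp
    (((h.matrix_conjTranspose.matrix_mul continuous_const).matrix_mul h).matrix_elem x x)

/-- The matching `e` depends on the point `p`, but its weights stay above half their value near `p`,
so it serves a whole neighbourhood with one constant. -/
theorem exists_bound_near {k m : ℕ} (hk : 0 < k) (hkm : Nat.Coprime k m)
    {A : Matrix (Fin k × Fin m) (Fin k × Fin m) ℂ} (hA : A.PosSemidef) (c : ℝ)
    (p : Matrix (Fin k) (Fin k) ℂ × Matrix (Fin m) (Fin m) ℂ)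
    (e : Fin k × Fin m ≃ Fin m × Fin k)
    (he : ∀ x, ((p.1 ⊗ₖ p.2)ᴴ * A * (p.1 ⊗ₖ p.2)) (x.1, (e x).1) (x.1, (e x).1) ≠ 0) :
    ∃ K : ℝ, ∀ᶠ q in nhds p, ∀ (a : Fin k → ℝ) (b : Fin m → ℝ), ∑ i, a i = 0 → ∑ j, b j = 0 →
      scaledTrace A q.1 q.2 a b ≤ c → ‖(a, b)‖ ≤ K := by
  classical
  set w : Matrix (Fin k) (Fin k) ℂ × Matrix (Fin m) (Fin m) ℂ → Fin k × Fin m → ℝ :=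
    fun q x => (((q.1 ⊗ₖ q.2)ᴴ * A * (q.1 ⊗ₖ q.2)) x x).re with hw
  have hw0 : ∀ q x, 0 ≤ w q x := fun q x =>
    (Complex.nonneg_iff.1 (scaledTrace_entry_nonneg hA q.1 q.2 x)).1
  have hpos : ∀ x, 0 < w p (x.1, (e x).1) := fun x =>
    (Complex.pos_iff.1 ((scaledTrace_entry_nonneg hA p.1 p.2 _).lt_of_ne' (he x))).1
  -- All terms of `scaledTrace` are nonnegative, so each is at most `c`; the factor 2 pays for the
  -- halved weights. Summing absolute values bounds all edges at once.
  set B : ℝ := ∑ x, |Real.log (2 * c / w p (x.1, (e x).1))|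
  obtain ⟨K, hK⟩ := exists_bound_of_equiv hk hkm e B
  refine ⟨K, ?_⟩
  have hev : ∀ᶠ q in nhds p, ∀ x, w p (x.1, (e x).1) / 2 < w q (x.1, (e x).1) := by
    refine Filter.eventually_all.2 fun x => ?_
    exact (continuous_kronecker_conj_entry A (x.1, (e x).1)).continuousAt.eventually
      (lt_mem_nhds (half_lt_self (hpos x)))
  filter_upwards [hev] with q hq a b ha hb hle
  refine hK a b ha hb fun x => ?_
  have hterm : w q (x.1, (e x).1) * (Real.exp (a x.1) * Real.exp (b (e x).1)) ≤ c := by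
    refine le_trans ?_ hle
    have h1 : ∀ i j, 0 ≤ w q (i, j) * (Real.exp (a i) * Real.exp (b j)) := fun i j =>
      mul_nonneg (hw0 _ _) (by positivity)
    refine le_trans ?_ (single_le_sum (f := fun i => ∑ j, w q (i, j) *
      (Real.exp (a i) * Real.exp (b j))) (fun i _ => sum_nonneg fun j _ => h1 i j)
      (mem_univ x.1))
    exact single_le_sum (f := fun j => w q (x.1, j) * (Real.exp (a x.1) * Real.exp (b j)))
      (fun j _ => h1 x.1 j) (mem_univ (e x).1)
  rw [← Real.exp_add] at hterm
  have hexp : Real.exp (a x.1 + b (e x).1) ≤ 2 * c / w p (x.1, (e x).1) := by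
    rw [le_div_iff₀ (hpos x)]
    nlinarith [hq x, Real.exp_pos (a x.1 + b (e x).1)]
  have hlog : a x.1 + b (e x).1 ≤ Real.log (2 * c / w p (x.1, (e x).1)) := by
    rw [Real.le_log_iff_exp_le ((Real.exp_pos _).trans_le hexp)]
    exact hexp
  exact (hlog.trans (le_abs_self _)).trans
    (single_le_sum (f := fun x => |Real.log (2 * c / w p (x.1, (e x).1))|)
      (fun _ _ => abs_nonneg _) (mem_univ x))

theorem continuous_scaledTrace {k m : ℕ} (A : Matrix (Fin k × Fin m) (Fin k × Fin m) ℂ) :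
    Continuous fun z : (Matrix (Fin k) (Fin k) ℂ × Matrix (Fin m) (Fin m) ℂ) ×
      ((Fin k → ℝ) × (Fin m → ℝ)) => scaledTrace A z.1.1 z.1.2 z.2.1 z.2.2 := by
  refine continuous_finsetSum _ fun i _ => continuous_finsetSum _ fun j _ => ?_
  refine ((continuous_kronecker_conj_entry A (i, j)).comp continuous_fst).mul ?_
  fun_prop

theorem exists_uniform_bound {k m : ℕ} (hk : 0 < k) (hkm : Nat.Coprime k m)
    {A : Matrix (Fin k × Fin m) (Fin k × Fin m) ℂ} (hA : A.PosSemidef)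
    (hsupp : ∀ (U : Matrix (Fin k) (Fin k) ℂ) (V : Matrix (Fin m) (Fin m) ℂ), Uᴴ * U = 1 →
      Vᴴ * V = 1 → ∃ e : Fin k × Fin m ≃ Fin m × Fin k, ∀ x,
        ((U ⊗ₖ V)ᴴ * A * (U ⊗ₖ V)) (x.1, (e x).1) (x.1, (e x).1) ≠ 0) (c : ℝ) :
    ∃ K : ℝ, ∀ (U : Matrix (Fin k) (Fin k) ℂ) (V : Matrix (Fin m) (Fin m) ℂ) (a : Fin k → ℝ)
      (b : Fin m → ℝ), Uᴴ * U = 1 → Vᴴ * V = 1 → ∑ i, a i = 0 → ∑ j, b j = 0 →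
        scaledTrace A U V a b ≤ c → ‖(a, b)‖ ≤ K := by
  obtain ⟨K, hK⟩ := ((isCompact_unitary k).prod (isCompact_unitary m)).induction_on
    (p := fun s => ∃ K : ℝ, ∀ q ∈ s, ∀ (a : Fin k → ℝ) (b : Fin m → ℝ),
      ∑ i, a i = 0 → ∑ j, b j = 0 → scaledTrace A q.1 q.2 a b ≤ c → ‖(a, b)‖ ≤ K)
    ⟨0, fun q hq => hq.elim⟩
    (fun s t hst ⟨K, hK⟩ => ⟨K, fun q hq => hK q (hst hq)⟩)
    (fun s t ⟨K, hK⟩ ⟨K', hK'⟩ => by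
      refine ⟨max K K', ?_⟩
      rintro q (hq | hq) a b ha hb h
      · exact (hK q hq a b ha hb h).trans (le_max_left _ _)
      · exact (hK' q hq a b ha hb h).trans (le_max_right _ _))
    (fun p hp => by
      obtain ⟨e, he⟩ := hsupp p.1 p.2 hp.1 hp.2
      obtain ⟨K, hK⟩ := exists_bound_near hk hkm hA c p e he
      exact ⟨_, mem_nhdsWithin_of_mem_nhds hK, K, fun q hq => hq⟩)
  exact ⟨K, fun U V a b hU hV => hK (U, V) ⟨hU, hV⟩ a b⟩

theorem exists_scaledTrace_min {k m : ℕ} (hk : 0 < k) (hkm : Nat.Coprime k m)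
    {A : Matrix (Fin k × Fin m) (Fin k × Fin m) ℂ} (hA : A.PosSemidef)
    (hsupp : ∀ (U : Matrix (Fin k) (Fin k) ℂ) (V : Matrix (Fin m) (Fin m) ℂ), Uᴴ * U = 1 →
      Vᴴ * V = 1 → ∃ e : Fin k × Fin m ≃ Fin m × Fin k, ∀ x,
        ((U ⊗ₖ V)ᴴ * A * (U ⊗ₖ V)) (x.1, (e x).1) (x.1, (e x).1) ≠ 0) :
    ∃ (U : Matrix (Fin k) (Fin k) ℂ) (V : Matrix (Fin m) (Fin m) ℂ) (a : Fin k → ℝ)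
      (b : Fin m → ℝ), Uᴴ * U = 1 ∧ Vᴴ * V = 1 ∧ ∑ i, a i = 0 ∧ ∑ j, b j = 0 ∧
      ∀ (U' : Matrix (Fin k) (Fin k) ℂ) (V' : Matrix (Fin m) (Fin m) ℂ) (a' : Fin k → ℝ)
        (b' : Fin m → ℝ), U'ᴴ * U' = 1 → V'ᴴ * V' = 1 → ∑ i, a' i = 0 → ∑ j, b' j = 0 →
        scaledTrace A U V a b ≤ scaledTrace A U' V' a' b' := by
  -- The threshold is the value at the base point `(1, 1, 0, 0)`: outside its sublevel set that
  -- point already does better.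
  obtain ⟨K, hK⟩ := exists_uniform_bound hk hkm hA hsupp (scaledTrace A 1 1 0 0)
  have hcompact : IsCompact (Metric.closedBall (0 : (Fin k → ℝ) × (Fin m → ℝ)) K ∩
      {p | ∑ i, p.1 i = 0 ∧ ∑ j, p.2 j = 0}) := by
    refine (isCompact_closedBall _ _).inter_right (IsClosed.and ?_ ?_)
    · exact isClosed_eq (by fun_prop) continuous_const
    · exact isClosed_eq (by fun_prop) continuous_const
  have hmem : ∀ U V a b, Uᴴ * U = 1 → Vᴴ * V = 1 → ∑ i, a i = 0 → ∑ j, b j = 0 →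
      scaledTrace A U V a b ≤ scaledTrace A 1 1 0 0 →
      ((U, V), (a, b)) ∈ ({U : Matrix (Fin k) (Fin k) ℂ | Uᴴ * U = 1} ×ˢ
        {V : Matrix (Fin m) (Fin m) ℂ | Vᴴ * V = 1}) ×ˢ
        (Metric.closedBall (0 : (Fin k → ℝ) × (Fin m → ℝ)) K ∩
          {p | ∑ i, p.1 i = 0 ∧ ∑ j, p.2 j = 0}) := by
    intro U V a b hU hV ha hb h
    exact ⟨⟨hU, hV⟩, mem_closedBall_zero_iff.2 (hK U V a b hU hV ha hb h), ha, hb⟩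
  have hbase := hmem 1 1 0 0 (by simp) (by simp) (by simp) (by simp) le_rfl
  obtain ⟨⟨⟨U, V⟩, a, b⟩, ⟨⟨hU, hV⟩, -, ha, hb⟩, hmin⟩ :=
    (((isCompact_unitary k).prod (isCompact_unitary m)).prod hcompact).exists_isMinOn ⟨_, hbase⟩
      (continuous_scaledTrace A).continuousOn
  have hle : ∀ z ∈ ({U : Matrix (Fin k) (Fin k) ℂ | Uᴴ * U = 1} ×ˢ
        {V : Matrix (Fin m) (Fin m) ℂ | Vᴴ * V = 1}) ×ˢ
        (Metric.closedBall (0 : (Fin k → ℝ) × (Fin m → ℝ)) K ∩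
          {p | ∑ i, p.1 i = 0 ∧ ∑ j, p.2 j = 0}),
      scaledTrace A U V a b ≤ scaledTrace A z.1.1 z.1.2 z.2.1 z.2.2 := hmin
  refine ⟨U, V, a, b, hU, hV, ha, hb, fun U' V' a' b' hU' hV' ha' hb' => ?_⟩
  by_cases h : scaledTrace A U' V' a' b' ≤ scaledTrace A 1 1 0 0
  · exact hle ((U', V'), (a', b')) (hmem U' V' a' b' hU' hV' ha' hb' h)
  · exact (hle ((1, 1), (0, 0)) hbase).trans (not_le.1 h).le

/-! ### Stationarity at the minimiser. -/

theorem trace_conj_mul_kronecker {k m : ℕ} (A : Matrix (Fin k × Fin m) (Fin k × Fin m) ℂ)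
    (X Q : Matrix (Fin k) (Fin k) ℂ) (Y R : Matrix (Fin m) (Fin m) ℂ) :
    trace ((X ⊗ₖ Y) * A * (X ⊗ₖ Y)ᴴ * (Q ⊗ₖ R)) =
      trace (A * ((Xᴴ * Q * X) ⊗ₖ (Yᴴ * R * Y))) := by
  rw [mul_kronecker_mul, mul_kronecker_mul, ← conjTranspose_kronecker, Matrix.mul_assoc,
    Matrix.mul_assoc, trace_mul_comm, Matrix.mul_assoc]

theorem exists_conj_eq_expConj {d : ℕ} {U : Matrix (Fin d) (Fin d) ℂ} (hU : Uᴴ * U = 1)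
    (a : Fin d → ℝ) : ∃ X : Matrix (Fin d) (Fin d) ℂ, IsUnit X ∧ Xᴴ * X = expConj U a := by
  have hX : (diagonal (fun i => (Real.exp (a i / 2) : ℂ)) * Uᴴ)ᴴ *
      (diagonal (fun i => (Real.exp (a i / 2) : ℂ)) * Uᴴ) = expConj U a := by
    rw [conjTranspose_mul, conjTranspose_conjTranspose, diagonal_conjTranspose, Matrix.mul_assoc,
      ← Matrix.mul_assoc (diagonal _), diagonal_mul_diagonal, expConj, Matrix.mul_assoc]
    congr 4
    ext i
    simp only [Pi.star_apply, Complex.star_def, Complex.conj_ofReal]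
    rw [← Complex.ofReal_mul, ← Real.exp_add, add_halves]
  refine ⟨_, ?_, hX⟩
  have h := (expConj_posDef hU a).isUnit
  rw [← hX] at h
  exact isUnit_of_mul_isUnit_right h

/-- The minimiser is factored as `Xᴴ X`, `Yᴴ Y` and absorbed into `A`. Since `Q ↦ Xᴴ Q X` preserves
positive definiteness and determinant one, the minimum for the conjugated matrix sits at the
identity. -/
theorem exists_trace_minimizer {k m : ℕ} (hk : 0 < k) (hkm : Nat.Coprime k m)
    {A : Matrix (Fin k × Fin m) (Fin k × Fin m) ℂ} (hA : A.PosSemidef)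
    (hsupp : ∀ (U : Matrix (Fin k) (Fin k) ℂ) (V : Matrix (Fin m) (Fin m) ℂ), Uᴴ * U = 1 →
      Vᴴ * V = 1 → ∃ e : Fin k × Fin m ≃ Fin m × Fin k, ∀ x,
        ((U ⊗ₖ V)ᴴ * A * (U ⊗ₖ V)) (x.1, (e x).1) (x.1, (e x).1) ≠ 0) :
    ∃ (X : Matrix (Fin k) (Fin k) ℂ) (Y : Matrix (Fin m) (Fin m) ℂ), IsUnit X ∧ IsUnit Y ∧
      ∀ (Q : Matrix (Fin k) (Fin k) ℂ) (R : Matrix (Fin m) (Fin m) ℂ), Q.PosDef → R.PosDef →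
        Q.det = 1 → R.det = 1 → (trace ((X ⊗ₖ Y) * A * (X ⊗ₖ Y)ᴴ)).re ≤
          (trace ((X ⊗ₖ Y) * A * (X ⊗ₖ Y)ᴴ * (Q ⊗ₖ R))).re := by
  obtain ⟨U, V, a, b, hU, hV, ha, hb, hmin⟩ := exists_scaledTrace_min hk hkm hA hsupp
  obtain ⟨X, hXu, hX⟩ := exists_conj_eq_expConj hU a
  obtain ⟨Y, hYu, hY⟩ := exists_conj_eq_expConj hV b
  have hdX : (Xᴴ * X).det = 1 := by rw [hX, det_expConj hU, ha]; simp
  have hdY : (Yᴴ * Y).det = 1 := by rw [hY, det_expConj hV, hb]; simp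
  refine ⟨X, Y, hXu, hYu, fun Q R hQ hR hdQ hdR => ?_⟩
  have h1 : trace ((X ⊗ₖ Y) * A * (X ⊗ₖ Y)ᴴ) =
      trace (A * (expConj U a ⊗ₖ expConj V b)) := by
    have := trace_conj_mul_kronecker A X 1 Y 1
    rwa [one_kronecker_one, Matrix.mul_one, Matrix.mul_one, Matrix.mul_one, hX, hY] at this
  obtain ⟨U', a', hU', ha', hQ'⟩ := exists_eq_expConj (Q := Xᴴ * Q * X)
    (hQ.conjTranspose_mul_mul_same (mulVec_injective_iff_isUnit.2 hXu))
    (by rw [det_mul, det_mul, hdQ, mul_one, ← det_mul, hdX])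
  obtain ⟨V', b', hV', hb', hR'⟩ := exists_eq_expConj (Q := Yᴴ * R * Y)
    (hR.conjTranspose_mul_mul_same (mulVec_injective_iff_isUnit.2 hYu))
    (by rw [det_mul, det_mul, hdR, mul_one, ← det_mul, hdY])
  rw [h1, trace_conj_mul_kronecker, hQ', hR', re_trace_mul_expConj, re_trace_mul_expConj]
  exact hmin U' V' a' b' hU' hV' ha' hb'

/-- A Hermitian matrix whose trace is minimal among its pairings with the positive definite
matrices of determinant one is scalar. -/
theorem eq_smul_one_of_trace_le {d : ℕ} (hd : 0 < d) {P : Matrix (Fin d) (Fin d) ℂ}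
    (hP : P.IsHermitian)
    (hmin : ∀ Q : Matrix (Fin d) (Fin d) ℂ, Q.PosDef → Q.det = 1 →
      (trace P).re ≤ (trace (P * Q)).re) :
    ∃ c : ℝ, P = (c : ℂ) • 1 := by
  classical
  set U : Matrix (Fin d) (Fin d) ℂ := hP.eigenvectorUnitary.1
  have hU : Uᴴ * U = 1 := mem_unitaryGroup_iff'.1 hP.eigenvectorUnitary.2
  have hU' : U * Uᴴ = 1 := mul_eq_one_comm.1 hU
  have hPU : P = U * diagonal (fun i => (hP.eigenvalues i : ℂ)) * Uᴴ := by
    conv_lhs => rw [hP.spectral_theorem, Unitary.conjStarAlgAut_apply]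
    rfl
  have htr : ∀ a : Fin d → ℝ,
      (trace (P * expConj U a)).re = ∑ i, hP.eigenvalues i * Real.exp (a i) := by
    intro a
    have : trace (P * expConj U a) =
        ((∑ i, hP.eigenvalues i * Real.exp (a i) : ℝ) : ℂ) := by
      conv_lhs => rw [hPU]
      rw [expConj, trace_mul_comm, ← Matrix.mul_assoc, ← Matrix.mul_assoc, trace_mul_comm]
      rw [show Uᴴ * (U * diagonal (fun i => (Real.exp (a i) : ℂ)) * Uᴴ * U *
        diagonal (fun i => (hP.eigenvalues i : ℂ))) = (Uᴴ * U) *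
          diagonal (fun i => (Real.exp (a i) : ℂ)) * (Uᴴ * U) *
        diagonal (fun i => (hP.eigenvalues i : ℂ)) by simp only [Matrix.mul_assoc]]
      rw [hU, Matrix.one_mul, Matrix.mul_one, diagonal_mul_diagonal, trace_diagonal]
      push_cast
      exact sum_congr rfl fun i _ => mul_comm _ _
    rw [this, Complex.ofReal_re]
  have htr0 : (trace P).re = ∑ i, hP.eigenvalues i := by
    have h1 : expConj U 0 = 1 := by simp [expConj, hU']
    have := htr 0
    rw [h1, Matrix.mul_one] at this
    simpa using this
  have heq : ∀ i j, hP.eigenvalues i = hP.eigenvalues j := by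
    intro i j
    -- Moving along `s` keeps the determinant equal to one, and the derivative at 0 is the
    -- difference of the two eigenvalues.
    set s : Fin d → ℝ := Pi.single i 1 - Pi.single j 1
    have hs : ∑ l, s l = 0 := by simp [s, sum_sub_distrib]
    have hder : HasDerivAt (fun t : ℝ => ∑ l, hP.eigenvalues l * Real.exp (t * s l))
        (∑ l, hP.eigenvalues l * (Real.exp (0 * s l) * (1 * s l))) 0 :=
      HasDerivAt.fun_sum fun l _ =>
        (((hasDerivAt_id (0 : ℝ)).mul_const (s l)).exp).const_mul _
    have hloc : IsLocalMin (fun t : ℝ => ∑ l, hP.eigenvalues l * Real.exp (t * s l)) 0 := by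
      refine Filter.Eventually.of_forall fun t => ?_
      have := hmin (expConj U (t • s)) (expConj_posDef hU _) (by
        rw [det_expConj hU]
        simp [← mul_sum, hs])
      rw [htr, htr0] at this
      simpa using this
    have h0 := hloc.hasDerivAt_eq_zero hder
    simp only [zero_mul, one_mul, s, Pi.sub_apply, mul_sub, sum_sub_distrib] at h0
    simp [Pi.single_apply] at h0
    linarith
  refine ⟨hP.eigenvalues ⟨0, hd⟩, ?_⟩
  conv_lhs => rw [hPU]
  have : diagonal (fun i => (hP.eigenvalues i : ℂ)) =
      (hP.eigenvalues ⟨0, hd⟩ : ℂ) • (1 : Matrix (Fin d) (Fin d) ℂ) := by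
    rw [smul_one_eq_diagonal]
    congr 1
    ext i
    rw [heq i ⟨0, hd⟩]
  rw [this, Matrix.mul_smul, Matrix.mul_one, Matrix.smul_mul, hU']

/-! ### Schmidt decompositions of balanced Hermitian matrices -/

/-- The spectral theorem for an operator symmetric with respect to a positive definite
bilinear form. -/
theorem exists_simultaneous_orthogonal {E : Type*} [AddCommGroup E] [Module ℝ E]
    [FiniteDimensional ℝ E] (B : E →ₗ[ℝ] E →ₗ[ℝ] ℝ) (hsymm : ∀ x y, B x y = B y x)
    (hnn : ∀ x, 0 ≤ B x x) (hdef : ∀ x, B x x = 0 → x = 0) (L : E →ₗ[ℝ] E)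
    (hL : ∀ x y, B (L x) y = B x (L y)) :
    ∃ (N : ℕ) (b : Fin N → E), (∀ i j, i ≠ j → B (b i) (b j) = 0) ∧
      (∀ i j, i ≠ j → B (L (b i)) (b j) = 0) ∧ ∀ x, x = ∑ i, B (b i) x • b i := by
  let core : InnerProductSpace.Core ℝ E :=
    { inner := fun x y => B x y
      conj_inner_symm := fun x y => by simpa using hsymm y x
      re_inner_nonneg := fun x => by simpa using hnn x
      add_left := fun x y z => by simp
      smul_left := fun x y r => by simp
      definite := hdef }
  let : NormedAddCommGroup E := core.toNormedAddCommGroup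
  let : InnerProductSpace ℝ E := InnerProductSpace.ofCore core.toCore
  have hin : ∀ x y : E, inner ℝ x y = B x y := fun _ _ => rfl
  have hsy : L.IsSymmetric := hL
  let b := hsy.eigenvectorBasis rfl
  have hb : ∀ i j, i ≠ j → B (b i) (b j) = 0 := fun i j hij => b.orthonormal.2 hij
  refine ⟨_, b, hb, fun i j hij => ?_, fun x => ?_⟩
  · have h1 : L (b i) = hsy.eigenvalues rfl i • b i := hsy.apply_eigenvectorBasis rfl i
    rw [h1, map_smul, LinearMap.smul_apply, hb i j hij, smul_zero]
  · exact (b.sum_repr' x).symm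

theorem sliceMap_mem_span {k m n : ℕ} (As : Fin n → Matrix (Fin k) (Fin k) ℂ)
    (Bs : Fin n → Matrix (Fin m) (Fin m) ℂ) (X : Matrix (Fin k) (Fin k) ℂ) :
    sliceMap As Bs X ∈ Submodule.span ℂ (Set.range Bs) := by
  change ∑ i, trace (As i * X) • Bs i ∈ _
  exact Submodule.sum_mem _ fun i _ =>
    Submodule.smul_mem _ _ (Submodule.subset_span (Set.mem_range_self i))

theorem sliceMap_conjTranspose {k m n : ℕ} {As : Fin n → Matrix (Fin k) (Fin k) ℂ}
    {Bs : Fin n → Matrix (Fin m) (Fin m) ℂ} (hA : (∑ i, As i ⊗ₖ Bs i).IsHermitian)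
    (X : Matrix (Fin k) (Fin k) ℂ) : (sliceMap As Bs X)ᴴ = sliceMap As Bs Xᴴ := by
  rw [ext_iff_trace_mul_right]
  intro Y
  rw [trace_sliceMap_mul, ← conjTranspose_conjTranspose Y, ← conjTranspose_mul,
    trace_conjTranspose, trace_mul_comm, trace_sliceMap_mul, ← conjTranspose_kronecker,
    ← trace_conjTranspose, conjTranspose_mul, hA.eq, trace_mul_comm]

theorem sliceMap_conjTranspose_symm {k m n : ℕ} {As : Fin n → Matrix (Fin k) (Fin k) ℂ}
    {Bs : Fin n → Matrix (Fin m) (Fin m) ℂ} (hA : (∑ i, As i ⊗ₖ Bs i).IsHermitian)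
    (Y : Matrix (Fin m) (Fin m) ℂ) : (sliceMap Bs As Y)ᴴ = sliceMap Bs As Yᴴ := by
  rw [ext_iff_trace_mul_right]
  intro X
  rw [trace_sliceMap_mul_symm, ← conjTranspose_conjTranspose X, ← conjTranspose_mul,
    trace_conjTranspose, trace_mul_comm, trace_sliceMap_mul_symm, ← conjTranspose_kronecker,
    ← trace_conjTranspose, conjTranspose_mul, hA.eq, trace_mul_comm]

/-- The real vector space of traceless Hermitian matrices. -/
def tracelessHermitian (k : ℕ) : Submodule ℝ (Matrix (Fin k) (Fin k) ℂ) where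
  carrier := {X | Xᴴ = X ∧ trace X = 0}
  add_mem' := by
    rintro X Y ⟨h1, h2⟩ ⟨h3, h4⟩
    exact ⟨by rw [conjTranspose_add, h1, h3], by rw [trace_add, h2, h4, add_zero]⟩
  zero_mem' := by simp
  smul_mem' := by
    rintro c X ⟨h1, h2⟩
    exact ⟨by rw [conjTranspose_smul, h1, star_trivial], by rw [trace_smul, h2, smul_zero]⟩

theorem trace_mul_eq_re {k : ℕ} {X Y : Matrix (Fin k) (Fin k) ℂ} (hX : Xᴴ = X) (hY : Yᴴ = Y) :
    trace (X * Y) = ((trace (X * Y)).re : ℂ) := by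
  refine (Complex.conj_eq_iff_re.1 ?_).symm
  rw [← Complex.star_def, ← trace_conjTranspose, conjTranspose_mul, hX, hY, trace_mul_comm]

/-- The trace form on traceless Hermitian matrices. -/
noncomputable def traceForm (k : ℕ) :
    tracelessHermitian k →ₗ[ℝ] tracelessHermitian k →ₗ[ℝ] ℝ :=
  LinearMap.mk₂ ℝ (fun X Y => (trace (X.1 * Y.1)).re)
    (fun X Y Z => by simp [Matrix.add_mul]) (fun c X Y => by simp)
    (fun X Y Z => by simp [Matrix.mul_add]) (fun c X Y => by simp)

theorem traceForm_apply {k : ℕ} (X Y : tracelessHermitian k) :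
    (traceForm k X Y : ℂ) = trace (X.1 * Y.1) :=
  (trace_mul_eq_re X.2.1 Y.2.1).symm

/-- The required orthogonality is bilinear, with no conjugate. On the real space of Hermitian
matrices the bilinear trace form is an inner product, so a real eigenbasis of `L` serves. -/
theorem exists_hermitian_diagonalization {k : ℕ}
    (L : Matrix (Fin k) (Fin k) ℂ →ₗ[ℂ] Matrix (Fin k) (Fin k) ℂ)
    (hmem : ∀ X, Xᴴ = X → trace X = 0 → (L X)ᴴ = L X ∧ trace (L X) = 0)
    (hL : ∀ X Y, trace (L X * Y) = trace (X * L Y)) :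
    ∃ (N : ℕ) (b : Fin N → Matrix (Fin k) (Fin k) ℂ), (∀ i, (b i)ᴴ = b i) ∧
      (∀ i, trace (b i) = 0) ∧ (∀ i j, i ≠ j → trace (b i * b j) = 0) ∧
      (∀ i j, i ≠ j → trace (L (b i) * b j) = 0) ∧
      ∀ X, Xᴴ = X → trace X = 0 → X = ∑ i, trace (b i * X) • b i := by
  let L' : tracelessHermitian k →ₗ[ℝ] tracelessHermitian k :=
    (L.restrictScalars ℝ).restrict fun X hX => hmem X hX.1 hX.2
  obtain ⟨N, b, h1, h2, h3⟩ := exists_simultaneous_orthogonal (traceForm k)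
    (fun X Y => by
      rw [← Complex.ofReal_inj, traceForm_apply, traceForm_apply, trace_mul_comm])
    (fun X => by
      have h := (posSemidef_conjTranspose_mul_self X.1).trace_nonneg
      rw [X.2.1, ← traceForm_apply] at h
      exact Complex.zero_le_real.1 h)
    (fun X hX => by
      rw [← Complex.ofReal_inj, traceForm_apply] at hX
      have h : (X.1ᴴ * X.1).trace = 0 := by rw [X.2.1, hX, Complex.ofReal_zero]
      exact Subtype.ext (trace_conjTranspose_mul_self_eq_zero_iff.1 h)) L'
    (fun X Y => by
      rw [← Complex.ofReal_inj, traceForm_apply, traceForm_apply]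
      exact hL X.1 Y.1)
  refine ⟨N, fun i => (b i).1, fun i => (b i).2.1, fun i => (b i).2.2, fun i j hij => ?_,
    fun i j hij => ?_, fun X hX hX0 => ?_⟩
  · rw [← traceForm_apply, h1 i j hij, Complex.ofReal_zero]
  · have := traceForm_apply (L' (b i)) (b j)
    rw [h2 i j hij, Complex.ofReal_zero] at this
    exact this.symm
  · have h := congrArg Subtype.val (h3 ⟨X, hX, hX0⟩)
    simp only [AddSubmonoidClass.coe_finsetSum, SetLike.val_smul] at h
    conv_lhs => rw [h]
    refine sum_congr rfl fun i _ => ?_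
    rw [← traceForm_apply (b i) ⟨X, hX, hX0⟩, Complex.coe_smul]

theorem eq_sum_of_hermitian {k : ℕ} {ι : Type*} [Fintype ι]
    (C : ι → Matrix (Fin k) (Fin k) ℂ)
    (h : ∀ X, Xᴴ = X → X = ∑ i, trace (X * C i) • C i) (X : Matrix (Fin k) (Fin k) ℂ) :
    X = ∑ i, trace (X * C i) • C i := by
  have h1 := h _ (realPart X).2
  have h2 := h _ (imaginaryPart X).2
  have h3 := realPart_add_I_smul_imaginaryPart X
  have h4 : X = ∑ i, trace ((realPart X : Matrix (Fin k) (Fin k) ℂ) * C i) • C i +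
      Complex.I • ∑ i, trace ((imaginaryPart X : Matrix (Fin k) (Fin k) ℂ) * C i) • C i := by
    rw [← h1, ← h2, h3]
  conv_lhs => rw [h4]
  rw [smul_sum, ← sum_add_distrib]
  refine sum_congr rfl fun i _ => ?_
  rw [smul_smul, ← add_smul]
  conv_rhs => rw [← h3]
  rw [Matrix.add_mul, trace_add, Matrix.smul_mul, trace_smul, smul_eq_mul]

theorem sum_kronecker_sliceMap {k m n : ℕ} {ι : Type*} [Fintype ι]
    (As : Fin n → Matrix (Fin k) (Fin k) ℂ) (Bs : Fin n → Matrix (Fin m) (Fin m) ℂ)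
    (C : ι → Matrix (Fin k) (Fin k) ℂ) (h : ∀ X, X = ∑ i, trace (X * C i) • C i) :
    ∑ l, As l ⊗ₖ Bs l = ∑ i, C i ⊗ₖ sliceMap As Bs (C i) := by
  have h1 : ∀ l, As l ⊗ₖ Bs l = ∑ i, trace (As l * C i) • (C i ⊗ₖ Bs l) := by
    intro l
    ext ⟨a, b⟩ ⟨c, d⟩
    have := congrFun (congrFun (h (As l)) a) c
    simp only [kroneckerMap_apply, Matrix.sum_apply, Matrix.smul_apply, smul_eq_mul] at this ⊢
    rw [this, sum_mul]
    simp only [mul_assoc]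
  rw [sum_congr rfl fun l _ => h1 l, sum_comm]
  refine sum_congr rfl fun i _ => ?_
  ext ⟨a, b⟩ ⟨c, d⟩
  simp only [sliceMap, LinearMap.coe_mk, AddHom.coe_mk, kroneckerMap_apply, Matrix.sum_apply,
    Matrix.smul_apply, smul_eq_mul, mul_sum]
  exact sum_congr rfl fun l _ => by ring

/-- Nonzero orthogonal Hermitian matrices are linearly independent. This limits the nonzero Schmidt
terms to the `n` available indices. -/
theorem card_le_of_trace_orthogonal {m n : ℕ} {ι : Type*} [Fintype ι]
    (D : ι → Matrix (Fin m) (Fin m) ℂ) (hD : ∀ i, (D i)ᴴ = D i) (h0 : ∀ i, D i ≠ 0)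
    (horth : ∀ i j, i ≠ j → trace (D i * D j) = 0) (Bs : Fin n → Matrix (Fin m) (Fin m) ℂ)
    (hspan : ∀ i, D i ∈ Submodule.span ℂ (Set.range Bs)) : Fintype.card ι ≤ n := by
  classical
  have hli : LinearIndependent ℂ D := by
    rw [Fintype.linearIndependent_iff]
    intro c hc i
    have h1 : trace ((∑ j, c j • D j) * D i) = 0 := by rw [hc]; simp
    rw [sum_mul, trace_sum, sum_eq_single i] at h1
    · rw [Matrix.smul_mul, trace_smul, smul_eq_mul, mul_eq_zero] at h1
      refine h1.resolve_right fun h2 => h0 i ?_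
      rw [← trace_conjTranspose_mul_self_eq_zero_iff, hD i, h2]
    · intro j _ hj
      rw [Matrix.smul_mul, trace_smul, horth j i hj, smul_zero]
    · simp
  rw [← finrank_span_eq_card hli]
  calc Module.finrank ℂ (Submodule.span ℂ (Set.range D))
      ≤ Module.finrank ℂ (Submodule.span ℂ (Set.range Bs)) := by
        refine Submodule.finrank_mono (Submodule.span_le.2 ?_)
        rintro _ ⟨i, rfl⟩
        exact hspan i
    _ ≤ Fintype.card (Fin n) := finrank_range_le_card Bs
    _ = n := Fintype.card_fin n

/-- Scalar marginals make `F` and `G` preserve tracelessness, so the identity splits off as the term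
`none`. As `tr (F (G X) Y) = tr (G X G Y)`, an eigenbasis of `F ∘ G` has orthogonal images under
`G`. -/
theorem exists_trace_orthogonal_decomposition {k m n : ℕ} (hk : 0 < k)
    {As : Fin n → Matrix (Fin k) (Fin k) ℂ} {Bs : Fin n → Matrix (Fin m) (Fin m) ℂ}
    (hA : (∑ i, As i ⊗ₖ Bs i).IsHermitian) {c d : ℂ}
    (hF : sliceMap Bs As 1 = c • 1) (hG : sliceMap As Bs 1 = d • 1) :
    ∃ (N : ℕ) (C : Option (Fin N) → Matrix (Fin k) (Fin k) ℂ),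
      C none = (((Real.sqrt k)⁻¹ : ℝ) : ℂ) • 1 ∧ (∀ i, (C i)ᴴ = C i) ∧
      (∀ i j, i ≠ j → trace (C i * C j) = 0) ∧
      (∀ i j, i ≠ j → trace (sliceMap As Bs (C i) * sliceMap As Bs (C j)) = 0) ∧
      ∑ i, As i ⊗ₖ Bs i = ∑ i, C i ⊗ₖ sliceMap As Bs (C i) := by
  have htrG : ∀ X, trace (sliceMap As Bs X) = c * trace X := by
    intro X
    have h := trace_sliceMap_mul As Bs X 1
    rw [← trace_sliceMap_mul_symm, hF] at h
    simpa using h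
  have htrF : ∀ Y, trace (sliceMap Bs As Y) = d * trace Y := by
    intro Y
    have h := trace_sliceMap_mul_symm As Bs 1 Y
    rw [← trace_sliceMap_mul, hG] at h
    simpa using h
  have hadj : ∀ X Y, trace (sliceMap Bs As (sliceMap As Bs X) * Y) =
      trace (sliceMap As Bs X * sliceMap As Bs Y) := by
    intro X Y
    rw [trace_sliceMap_mul_symm, ← trace_sliceMap_mul, trace_mul_comm]
  obtain ⟨N, b, hb, hb0, hbb, hLb, hsum⟩ := exists_hermitian_diagonalization
    (sliceMap Bs As ∘ₗ sliceMap As Bs)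
    (fun X hX hX0 => by
      simp only [LinearMap.comp_apply]
      rw [sliceMap_conjTranspose_symm hA, sliceMap_conjTranspose hA, hX, htrF, htrG, hX0]
      simp)
    (fun X Y => by
      simp only [LinearMap.comp_apply]
      rw [hadj, trace_mul_comm, ← hadj, trace_mul_comm])
  have hk' : ((Real.sqrt k)⁻¹ * (Real.sqrt k)⁻¹ : ℝ) = (k : ℝ)⁻¹ := by
    rw [← mul_inv, Real.mul_self_sqrt (Nat.cast_nonneg k)]
  refine ⟨N, fun o => o.elim ((((Real.sqrt k)⁻¹ : ℝ) : ℂ) • 1) b, rfl, ?_, ?_, ?_, ?_⟩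
  · rintro (_ | i)
    · simp
    · exact hb i
  · rintro (_ | i) (_ | j) hij
    · exact absurd rfl hij
    · simp [hb0]
    · simp [hb0]
    · exact hbb i j fun h => hij (h ▸ rfl)
  · rintro (_ | i) (_ | j) hij
    · exact absurd rfl hij
    · simp [hG, htrG, hb0]
    · simp [hG, htrG, hb0]
    · have h := hLb i j fun h => hij (h ▸ rfl)
      rwa [LinearMap.comp_apply, hadj] at h
  · refine sum_kronecker_sliceMap As Bs _ (eq_sum_of_hermitian _ fun X hX => ?_)
    have hreal : star (trace X) = trace X := by rw [← trace_conjTranspose, hX]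
    -- The traceless part of `X` is expanded in `b`; the subtracted part is exactly the `none` term.
    have h1 := hsum (X - ((k : ℂ)⁻¹ * trace X) • 1)
      (by rw [conjTranspose_sub, hX, conjTranspose_smul, star_mul', hreal]; simp)
      (by simp [mul_comm _ (trace X), hk.ne'])
    have h2 : ∀ i, trace (b i * (X - ((k : ℂ)⁻¹ * trace X) • 1)) = trace (X * b i) := by
      intro i
      rw [Matrix.mul_sub, trace_sub, Matrix.mul_smul, trace_smul, Matrix.mul_one, hb0,
        smul_zero, sub_zero, trace_mul_comm]
    simp only [h2] at h1
    rw [Fintype.sum_option]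
    simp only [Option.elim]
    rw [← h1, Matrix.mul_smul, trace_smul, Matrix.mul_one, smul_smul, smul_eq_mul,
      mul_right_comm, ← Complex.ofReal_mul, hk']
    simp

/-- The terms with `D i = 0` are dropped, the rest are injected into `Fin n`, and the free places
are filled with zeros. The constant `√k / √m` makes `G` send `Id / √k` to `Id / √m`. -/
theorem exists_normal_form {k m n : ℕ} (hk : 0 < k) (hm : 0 < m)
    {As : Fin n → Matrix (Fin k) (Fin k) ℂ} {Bs : Fin n → Matrix (Fin m) (Fin m) ℂ}
    (hA : (∑ i, As i ⊗ₖ Bs i).IsHermitian) {c : ℂ} (hF : sliceMap Bs As 1 = c • 1)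
    (hG : sliceMap As Bs 1 = ((Real.sqrt k / Real.sqrt m : ℝ) : ℂ) • 1) :
    ∃ (C : Fin n → Matrix (Fin k) (Fin k) ℂ) (D : Fin n → Matrix (Fin m) (Fin m) ℂ),
      ∑ i, As i ⊗ₖ Bs i = ∑ i, C i ⊗ₖ D i ∧
      (∃ h : 0 < n,
        C ⟨0, h⟩ = (((Real.sqrt k)⁻¹ : ℝ) : ℂ) • (1 : Matrix (Fin k) (Fin k) ℂ) ∧
        D ⟨0, h⟩ = (((Real.sqrt m)⁻¹ : ℝ) : ℂ) • (1 : Matrix (Fin m) (Fin m) ℂ)) ∧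
      ∀ i j, i ≠ j → trace (C i * C j) = 0 ∧ trace (D i * D j) = 0 := by
  classical
  obtain ⟨N, C, hC0, hC, hCC, hDD, hsum⟩ := exists_trace_orthogonal_decomposition hk hA hF hG
  set D := fun i => sliceMap As Bs (C i) with hD
  have hsk : Real.sqrt k ≠ 0 := (Real.sqrt_pos.2 (by exact_mod_cast hk)).ne'
  have hsm : Real.sqrt m ≠ 0 := (Real.sqrt_pos.2 (by exact_mod_cast hm)).ne'
  have hD0 : D none = (((Real.sqrt m)⁻¹ : ℝ) : ℂ) • 1 := by
    simp only [hD]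
    rw [hC0, map_smul, hG, smul_smul, ← Complex.ofReal_mul]
    congr 3
    field_simp
  have : Nonempty (Fin m) := ⟨⟨0, hm⟩⟩
  have hD0' : D none ≠ 0 := by
    rw [hD0]
    exact smul_ne_zero (by exact_mod_cast inv_ne_zero hsm) one_ne_zero
  have hcard : Fintype.card {i // D i ≠ 0} ≤ n := by
    refine card_le_of_trace_orthogonal (fun i : {i // D i ≠ 0} => D i)
      (fun i => by simp only [hD]; rw [sliceMap_conjTranspose hA, hC]) (fun i => i.2)
      (fun i j hij => hDD _ _ fun h => hij (Subtype.ext h)) Bs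
      fun i => sliceMap_mem_span As Bs (C i)
  obtain ⟨f⟩ : Nonempty ({i // D i ≠ 0} ↪ Fin n) :=
    Function.Embedding.nonempty_of_card_le (by simpa using hcard)
  have hn : 0 < n := (f ⟨none, hD0'⟩).pos
  -- The swap places the identity term at index 0.
  set g : {i // D i ≠ 0} → Fin n := fun i => Equiv.swap (f ⟨none, hD0'⟩) ⟨0, hn⟩ (f i)
  have hg : Function.Injective g := (Equiv.injective _).comp f.injective
  have hg0 : g ⟨none, hD0'⟩ = ⟨0, hn⟩ := Equiv.swap_apply_left _ _
  have hval : ∀ {d : ℕ} (M : Option (Fin N) → Matrix (Fin d) (Fin d) ℂ) i,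
      Function.extend g (fun i => M i.1) 0 (g i) = M i.1 := fun M i => hg.extend_apply _ _ i
  have hout : ∀ {d : ℕ} (M : Option (Fin N) → Matrix (Fin d) (Fin d) ℂ) l,
      (¬ ∃ i, g i = l) → Function.extend g (fun i => M i.1) 0 l = 0 := fun M l h =>
    Function.extend_apply' _ _ _ h
  have horth : ∀ {d : ℕ} (M : Option (Fin N) → Matrix (Fin d) (Fin d) ℂ),
      (∀ i j, i ≠ j → trace (M i * M j) = 0) → ∀ l l', l ≠ l' →
      trace (Function.extend g (fun i => M i.1) 0 l *
        Function.extend g (fun i => M i.1) 0 l') = 0 := by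
    intro d M hM l l' hll
    by_cases h : ∃ i, g i = l
    · by_cases h' : ∃ i, g i = l'
      · obtain ⟨i, rfl⟩ := h
        obtain ⟨j, rfl⟩ := h'
        rw [hval, hval]
        exact hM _ _ fun h => hll (congrArg g (Subtype.ext h))
      · rw [hout M l' h', Matrix.mul_zero, trace_zero]
    · rw [hout M l h, Matrix.zero_mul, trace_zero]
  refine ⟨Function.extend g (fun i => C i.1) 0, Function.extend g (fun i => D i.1) 0, ?_,
    ⟨hn, ?_, ?_⟩, fun l l' h => ⟨horth C hCC l l' h, horth D hDD l l' h⟩⟩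
  · rw [hsum, ← Fintype.sum_subtype_add_sum_subtype (fun i => D i ≠ 0)]
    rw [← Fintype.sum_of_injective g hg (fun i => C i.1 ⊗ₖ D i.1) _ ?_ ?_]
    · rw [add_eq_left]
      refine sum_eq_zero fun i _ => ?_
      have h0 : sliceMap As Bs (C i.1) = 0 := not_not.1 i.2
      rw [h0, kronecker_zero]
    · intro l hl
      rw [hout D l hl, kronecker_zero]
    · intro i
      rw [hval, hval]
  · rw [← hg0, hval, hC0]
  · rw [← hg0, hval, hD0]

/-! ### Filter normal form and support -/

/-- Orthogonality to a multiple of the identity means trace zero, so only the first term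
contributes, with `tr C₁ = √k`. -/
theorem sliceMap_one_of_trace_orthogonal {k m n : ℕ} (hk : 0 < k)
    {C : Fin n → Matrix (Fin k) (Fin k) ℂ} {D : Fin n → Matrix (Fin m) (Fin m) ℂ} (h : 0 < n)
    (hC : C ⟨0, h⟩ = (((Real.sqrt k)⁻¹ : ℝ) : ℂ) • (1 : Matrix (Fin k) (Fin k) ℂ))
    (hD : D ⟨0, h⟩ = (((Real.sqrt m)⁻¹ : ℝ) : ℂ) • (1 : Matrix (Fin m) (Fin m) ℂ))
    (horth : ∀ i j, i ≠ j → trace (C i * C j) = 0) :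
    sliceMap C D 1 = ((Real.sqrt k / Real.sqrt m : ℝ) : ℂ) • 1 := by
  have hsk : Real.sqrt k ≠ 0 := (Real.sqrt_pos.2 (by exact_mod_cast hk)).ne'
  have h0 : ∀ i, i ≠ ⟨0, h⟩ → trace (C i) = 0 := by
    intro i hi
    have := horth _ _ hi.symm
    rw [hC, Matrix.smul_mul, Matrix.one_mul, trace_smul, smul_eq_mul, mul_eq_zero] at this
    exact this.resolve_left (by exact_mod_cast inv_ne_zero hsk)
  have hs : sliceMap C D 1 = ∑ i, trace (C i) • D i := by simp [sliceMap]
  rw [hs, sum_eq_single ⟨0, h⟩ (fun i _ hi => by rw [h0 i hi, zero_smul]) (by simp), hC, hD,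
    trace_smul, trace_one, smul_smul, Fintype.card_fin, smul_eq_mul]
  have hk' : ((k : ℝ) : ℂ) = k := Complex.ofReal_natCast k
  rw [← hk', ← Complex.ofReal_mul, ← Complex.ofReal_mul]
  congr 2
  have hk2 : (k : ℝ) = Real.sqrt k * Real.sqrt k := (Real.mul_self_sqrt (Nat.cast_nonneg k)).symm
  rw [div_eq_mul_inv]
  congr 1
  nth_rewrite 2 [hk2]
  rw [inv_mul_cancel_left₀ hsk]

theorem exists_matching_of_balanced {k m : ℕ} (hk : 0 < k) (hm : 0 < m)
    {A : Matrix (Fin k × Fin m) (Fin k × Fin m) ℂ} (hA : A.PosSemidef)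
    (hα : ∀ Q : Matrix (Fin k) (Fin k) ℂ, trace (A * (Q ⊗ₖ (1 : Matrix (Fin m) (Fin m) ℂ))) =
      ((Real.sqrt m / Real.sqrt k : ℝ) : ℂ) * trace Q)
    (hβ : ∀ Q : Matrix (Fin m) (Fin m) ℂ, trace (A * ((1 : Matrix (Fin k) (Fin k) ℂ) ⊗ₖ Q)) =
      ((Real.sqrt k / Real.sqrt m : ℝ) : ℂ) * trace Q)
    {U : Matrix (Fin k) (Fin k) ℂ} {V : Matrix (Fin m) (Fin m) ℂ} (hU : IsUnit U)
    (hV : IsUnit V) :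
    ∃ e : Fin k × Fin m ≃ Fin m × Fin k, ∀ x,
      ((U ⊗ₖ V)ᴴ * A * (U ⊗ₖ V)) (x.1, (e x).1) (x.1, (e x).1) ≠ 0 := by
  classical
  refine exists_equiv_of_card_le
    (fun i j => ((U ⊗ₖ V)ᴴ * A * (U ⊗ₖ V)) (i, j) (i, j) ≠ 0) fun S => ?_
  set N := S.biUnion fun i =>
    univ.filter fun j => ((U ⊗ₖ V)ᴴ * A * (U ⊗ₖ V)) (i, j) (i, j) ≠ 0 with hN
  have h := card_add_card_le_of_balanced hA hα hβ hU hV S Nᶜ (fun i hi j hj => by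
    by_contra hne
    refine mem_compl.1 hj (mem_biUnion.2 ⟨i, hi, ?_⟩)
    simpa using hne)
  have hc : (#Nᶜ : ℝ) = m - #N := by
    rw [card_compl, Fintype.card_fin, Nat.cast_sub (by simpa using card_le_univ N)]
  have hsk : 0 < Real.sqrt k := Real.sqrt_pos.2 (by exact_mod_cast hk)
  have hsm : 0 < Real.sqrt m := Real.sqrt_pos.2 (by exact_mod_cast hm)
  have hk2 := Real.mul_self_sqrt (Nat.cast_nonneg (α := ℝ) k)
  have hm2 := Real.mul_self_sqrt (Nat.cast_nonneg (α := ℝ) m)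
  -- Multiplying by `√k √m` turns the coefficients `√m / √k` and `√k / √m` into `m` and `k`.
  have h1 := mul_le_mul_of_nonneg_right h (mul_pos hsk hsm).le
  have e1 : Real.sqrt m / Real.sqrt k * (Real.sqrt k * Real.sqrt m) = m := by
    field_simp
    nlinarith
  have e2 : Real.sqrt k / Real.sqrt m * (Real.sqrt k * Real.sqrt m) = k := by
    field_simp
    nlinarith
  have h2 : (m : ℝ) * #S + k * (m - #N) ≤ m * k := by
    calc (m : ℝ) * #S + k * (m - #N) = (Real.sqrt m / Real.sqrt k * #S +
          Real.sqrt k / Real.sqrt m * #Nᶜ) * (Real.sqrt k * Real.sqrt m) := by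
          rw [add_mul, mul_right_comm, e1, mul_right_comm _ (#Nᶜ : ℝ), e2, hc]
      _ ≤ _ := h1
      _ = m * k := by rw [mul_right_comm, e1]
  have h3 : (m : ℝ) * #S ≤ k * #N := by linarith
  exact_mod_cast h3

theorem mapHasSupport_of_normal_form {k m n : ℕ} (hk : 0 < k) (hm : 0 < m)
    {As : Fin n → Matrix (Fin k) (Fin k) ℂ} {Bs : Fin n → Matrix (Fin m) (Fin m) ℂ}
    (hA : (∑ i, As i ⊗ₖ Bs i).PosSemidef) {X : Matrix (Fin k) (Fin k) ℂ}
    {Y : Matrix (Fin m) (Fin m) ℂ} (hX : IsUnit X) (hY : IsUnit Y)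
    {C : Fin n → Matrix (Fin k) (Fin k) ℂ} {D : Fin n → Matrix (Fin m) (Fin m) ℂ}
    (hsum : (X ⊗ₖ Y) * (∑ i, As i ⊗ₖ Bs i) * (X ⊗ₖ Y)ᴴ = ∑ i, C i ⊗ₖ D i) (h : 0 < n)
    (hC : C ⟨0, h⟩ = (((Real.sqrt k)⁻¹ : ℝ) : ℂ) • (1 : Matrix (Fin k) (Fin k) ℂ))
    (hD : D ⟨0, h⟩ = (((Real.sqrt m)⁻¹ : ℝ) : ℂ) • (1 : Matrix (Fin m) (Fin m) ℂ))
    (horth : ∀ i j, i ≠ j → trace (C i * C j) = 0 ∧ trace (D i * D j) = 0) :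
    MapHasSupport (sliceMap As Bs) := by
  have hG := sliceMap_one_of_trace_orthogonal hk h hC hD fun i j hij => (horth i j hij).1
  have hF := sliceMap_one_of_trace_orthogonal hm h hD hC fun i j hij => (horth i j hij).2
  have hpsd := hA.mul_mul_conjTranspose_same (X ⊗ₖ Y)
  rw [mapHasSupport_sliceMap_iff]
  intro U V hU hV
  have hXd := (isUnit_iff_isUnit_det _).1 hX
  have hYd := (isUnit_iff_isUnit_det _).1 hY
  obtain ⟨e, he⟩ := exists_matching_of_balanced hk hm hpsd
    (fun Q => by
      rw [hsum, ← trace_sliceMap_mul_symm, hF, Matrix.smul_mul, Matrix.one_mul, trace_smul,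
        smul_eq_mul])
    (fun Q => by
      rw [hsum, ← trace_sliceMap_mul, hG, Matrix.smul_mul, Matrix.one_mul, trace_smul,
        smul_eq_mul])
    -- These factors undo the conjugation by `X ⊗ Y`. They need not be unitary, which is why the
    -- matching lemma asks only for invertibility.
    (U := (X⁻¹)ᴴ * U) (V := (Y⁻¹)ᴴ * V)
    ((isUnit_nonsing_inv_iff.2 hX).star.mul (isUnit_of_conjTranspose_mul_self hU))
    ((isUnit_nonsing_inv_iff.2 hY).star.mul (isUnit_of_conjTranspose_mul_self hV))
  refine ⟨e, fun x => ?_⟩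
  have hUV : (X ⊗ₖ Y)ᴴ * (((X⁻¹)ᴴ * U) ⊗ₖ ((Y⁻¹)ᴴ * V)) = U ⊗ₖ V := by
    rw [conjTranspose_kronecker, ← mul_kronecker_mul, ← Matrix.mul_assoc, ← Matrix.mul_assoc,
      ← conjTranspose_mul, ← conjTranspose_mul, nonsing_inv_mul _ hXd, nonsing_inv_mul _ hYd,
      conjTranspose_one, conjTranspose_one, Matrix.one_mul, Matrix.one_mul]
  have hx := he x
  have heq : (((X⁻¹)ᴴ * U) ⊗ₖ ((Y⁻¹)ᴴ * V))ᴴ * ((X ⊗ₖ Y) * (∑ i, As i ⊗ₖ Bs i) * (X ⊗ₖ Y)ᴴ) *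
      (((X⁻¹)ᴴ * U) ⊗ₖ ((Y⁻¹)ᴴ * V)) =
      (U ⊗ₖ V)ᴴ * (∑ i, As i ⊗ₖ Bs i) * (U ⊗ₖ V) := by
    rw [← hUV, conjTranspose_mul, conjTranspose_conjTranspose]
    simp only [Matrix.mul_assoc]
  rwa [heq] at hx

/-! ### From support to the normal form. -/

theorem sliceMap_smul_left {k m n : ℕ} (t : ℂ) (As : Fin n → Matrix (Fin k) (Fin k) ℂ)
    (Bs : Fin n → Matrix (Fin m) (Fin m) ℂ) (X : Matrix (Fin k) (Fin k) ℂ) :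
    sliceMap (fun i => t • As i) Bs X = t • sliceMap As Bs X := by
  simp [sliceMap, smul_sum, mul_smul]

theorem sliceMap_smul_right {k m n : ℕ} (t : ℂ) (As : Fin n → Matrix (Fin k) (Fin k) ℂ)
    (Bs : Fin n → Matrix (Fin m) (Fin m) ℂ) (X : Matrix (Fin k) (Fin k) ℂ) :
    sliceMap As (fun i => t • Bs i) X = t • sliceMap As Bs X := by
  simp [sliceMap, smul_sum, smul_comm t]

/-- If `G_A` has support, then `A` can be scaled so that both partial traces are scalar. -/
theorem exists_scaling_of_mapHasSupport {k m n : ℕ} (hk : 0 < k) (hm : 0 < m)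
    (hkm : Nat.Coprime k m)
    {As : Fin n → Matrix (Fin k) (Fin k) ℂ} {Bs : Fin n → Matrix (Fin m) (Fin m) ℂ}
    (hA : (∑ i, As i ⊗ₖ Bs i).PosSemidef) (hsupp : MapHasSupport (sliceMap As Bs)) :
    ∃ (X : Matrix (Fin k) (Fin k) ℂ) (Y : Matrix (Fin m) (Fin m) ℂ) (c d : ℝ),
      IsUnit X ∧ IsUnit Y ∧ 0 < d ∧
      sliceMap (fun i => Y * Bs i * Yᴴ) (fun i => X * As i * Xᴴ) 1 = (c : ℂ) • 1 ∧
      sliceMap (fun i => X * As i * Xᴴ) (fun i => Y * Bs i * Yᴴ) 1 = (d : ℂ) • 1 := by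
  rw [mapHasSupport_sliceMap_iff] at hsupp
  obtain ⟨X, Y, hX, hY, hmin⟩ := exists_trace_minimizer hk hkm hA hsupp
  have hpsd := hA.mul_mul_conjTranspose_same (X ⊗ₖ Y)
  -- A zero trace would force `A = 0`, contradicting support; this gives `d > 0` below.
  have hne : trace ((X ⊗ₖ Y) * (∑ i, As i ⊗ₖ Bs i) * (X ⊗ₖ Y)ᴴ) ≠ 0 := by
    intro h0
    rw [hpsd.trace_eq_zero_iff] at h0
    have hZ : IsUnit (X ⊗ₖ Y) := by
      rw [isUnit_iff_isUnit_det, det_kronecker]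
      exact (((isUnit_iff_isUnit_det _).1 hX).pow _).mul (((isUnit_iff_isUnit_det _).1 hY).pow _)
    have hA0 : ∑ i, As i ⊗ₖ Bs i = 0 := by
      have hZ' : IsUnit (X ⊗ₖ Y)ᴴ := hZ.star
      rwa [hZ'.mul_left_eq_zero, hZ.mul_right_eq_zero] at h0
    obtain ⟨e, he⟩ := hsupp 1 1 (by simp) (by simp)
    exact he (⟨0, hk⟩, ⟨0, hm⟩) (by simp [hA0])
  have hpos := lt_of_le_of_ne hpsd.trace_nonneg hne.symm
  rw [sum_conj_kronecker] at hmin hpsd hpos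
  set Es := fun i => X * As i * Xᴴ
  set Hs := fun i => Y * Bs i * Yᴴ
  have hherm := hpsd.isHermitian
  have htr : trace (sliceMap Es Hs 1) = trace (∑ i, Es i ⊗ₖ Hs i) := by
    simpa using trace_sliceMap_mul Es Hs 1 1
  have htr' : trace (sliceMap Hs Es 1) = trace (∑ i, Es i ⊗ₖ Hs i) := by
    simpa using trace_sliceMap_mul_symm Es Hs 1 1
  -- Each marginal is treated separately by keeping the other factor of the minimisation at the
  -- identity.
  obtain ⟨c, hc⟩ := eq_smul_one_of_trace_le hk (P := sliceMap Hs Es 1)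
    (by rw [IsHermitian, sliceMap_conjTranspose_symm hherm, conjTranspose_one])
    (fun Q hQ hdet => by
      rw [htr', trace_sliceMap_mul_symm]
      exact hmin Q 1 hQ PosDef.one hdet det_one)
  obtain ⟨d, hd⟩ := eq_smul_one_of_trace_le hm (P := sliceMap Es Hs 1)
    (by rw [IsHermitian, sliceMap_conjTranspose hherm, conjTranspose_one])
    (fun Q hQ hdet => by
      rw [htr, trace_sliceMap_mul]
      exact hmin 1 Q PosDef.one hQ det_one hdet)
  refine ⟨X, Y, c, d, hX, hY, ?_, hc, hd⟩
  rw [← htr, hd, trace_smul, trace_one, Fintype.card_fin, smul_eq_mul] at hpos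
  have hpos' : (0 : ℂ) < ((d * m : ℝ) : ℂ) := by
    push_cast
    exact hpos
  exact pos_of_mul_pos_left (Complex.zero_lt_real.1 hpos') (Nat.cast_nonneg m)

theorem exists_normal_form_of_mapHasSupport {k m n : ℕ} (hk : 0 < k) (hm : 0 < m)
    (hkm : Nat.Coprime k m)
    {As : Fin n → Matrix (Fin k) (Fin k) ℂ} {Bs : Fin n → Matrix (Fin m) (Fin m) ℂ}
    (hA : (∑ i, As i ⊗ₖ Bs i).PosSemidef) (hsupp : MapHasSupport (sliceMap As Bs)) :
    ∃ (X : Matrix (Fin k) (Fin k) ℂ) (Y : Matrix (Fin m) (Fin m) ℂ),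
      IsUnit X ∧ IsUnit Y ∧
      ∃ (C : Fin n → Matrix (Fin k) (Fin k) ℂ) (D : Fin n → Matrix (Fin m) (Fin m) ℂ),
        (X ⊗ₖ Y) * (∑ i, As i ⊗ₖ Bs i) * (X ⊗ₖ Y)ᴴ = ∑ i, C i ⊗ₖ D i ∧
        (∃ h : 0 < n,
          C ⟨0, h⟩ = (((Real.sqrt k)⁻¹ : ℝ) : ℂ) • (1 : Matrix (Fin k) (Fin k) ℂ) ∧
          D ⟨0, h⟩ = (((Real.sqrt m)⁻¹ : ℝ) : ℂ) • (1 : Matrix (Fin m) (Fin m) ℂ)) ∧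
        ∀ i j, i ≠ j → trace (C i * C j) = 0 ∧ trace (D i * D j) = 0 := by
  obtain ⟨X, Y, c, d, hX, hY, hd, hF, hG⟩ := exists_scaling_of_mapHasSupport hk hm hkm hA hsupp
  have hsk : 0 < Real.sqrt k := Real.sqrt_pos.2 (by exact_mod_cast hk)
  have hsm : 0 < Real.sqrt m := Real.sqrt_pos.2 (by exact_mod_cast hm)
  -- Scaling `X` by `s = √t` multiplies both marginals by `t`, which turns `d` into `√k / √m`.
  set t : ℝ := Real.sqrt k / Real.sqrt m / d with ht
  have htpos : 0 < t := by positivity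
  set s : ℝ := Real.sqrt t
  have hs : 0 < s := Real.sqrt_pos.2 htpos
  have hss : (s : ℂ) * s = t := by
    rw [← Complex.ofReal_mul, Real.mul_self_sqrt htpos.le]
  have hEs : (fun i => ((s : ℂ) • X) * As i * ((s : ℂ) • X)ᴴ) =
      fun i => (t : ℂ) • (X * As i * Xᴴ) := by
    funext i
    rw [conjTranspose_smul, Complex.star_def, Complex.conj_ofReal, Matrix.mul_smul,
      Matrix.smul_mul, Matrix.smul_mul, smul_smul, hss]
  have hsX : IsUnit ((s : ℂ) • X) := by
    have : (s : ℂ) ≠ 0 := by exact_mod_cast hs.ne'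
    exact hX.smul (Units.mk0 _ this)
  refine ⟨(s : ℂ) • X, Y, hsX, hY, ?_⟩
  have hherm := (hA.mul_mul_conjTranspose_same (((s : ℂ) • X) ⊗ₖ Y)).isHermitian
  rw [sum_conj_kronecker] at hherm ⊢
  refine exists_normal_form hk hm hherm (c := t * c) ?_ ?_
  · rw [hEs, sliceMap_smul_right, hF, smul_smul]
  · rw [hEs, sliceMap_smul_left, hG, smul_smul, ← Complex.ofReal_mul, ht,
      div_mul_cancel₀ _ hd.ne']

end FilterNormalForm
theorem corollary4p2 {k m n : ℕ}
    (A : Matrix (Fin k × Fin m) (Fin k × Fin m) ℂ)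
    (As : Fin n → Matrix (Fin k) (Fin k) ℂ) (Bs : Fin n → Matrix (Fin m) (Fin m) ℂ)
    (hdec : A = ∑ i, As i ⊗ₖ Bs i)
    (hA : A.PosSemidef)
    (hG : (FilterNormalForm.sliceMap As Bs 1).PosDef)
    (hF : (FilterNormalForm.sliceMap Bs As 1).PosDef)
    (hkm : Nat.Coprime k m) :
    (∃ (X : Matrix (Fin k) (Fin k) ℂ) (Y : Matrix (Fin m) (Fin m) ℂ),
      IsUnit X ∧ IsUnit Y ∧
      ∃ (C : Fin n → Matrix (Fin k) (Fin k) ℂ) (D : Fin n → Matrix (Fin m) (Fin m) ℂ),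
        (X ⊗ₖ Y) * A * (X ⊗ₖ Y).conjTranspose = ∑ i, C i ⊗ₖ D i ∧
        (∃ h : 0 < n,
          C ⟨0, h⟩ = (((Real.sqrt k)⁻¹ : ℝ) : ℂ) • (1 : Matrix (Fin k) (Fin k) ℂ) ∧
          D ⟨0, h⟩ = (((Real.sqrt m)⁻¹ : ℝ) : ℂ) • (1 : Matrix (Fin m) (Fin m) ℂ)) ∧
        ∀ i j, i ≠ j →
          Matrix.trace (C i * C j) = 0 ∧ Matrix.trace (D i * D j) = 0) ↔
    FilterNormalForm.MapHasSupport (FilterNormalForm.sliceMap As Bs) := by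
  subst hdec
  -- For `k = 0` coprimality forces `m = 1`, and `G_A(Id)` would be the zero `1 × 1` matrix, which
  -- is not positive definite; `m = 0` is symmetric.
  have hk : 0 < k := by
    rcases Nat.eq_zero_or_pos k with rfl | h
    · obtain rfl : m = 1 := by simpa using hkm
      have h0 := hG.diag_pos (i := 0)
      simp [FilterNormalForm.sliceMap] at h0
    · exact h
  have hm : 0 < m := by
    rcases Nat.eq_zero_or_pos m with rfl | h
    · obtain rfl : k = 1 := by simpa using hkm
      have h0 := hF.diag_pos (i := 0)
      simp [FilterNormalForm.sliceMap] at h0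
    · exact h
  constructor
  · rintro ⟨X, Y, hX, hY, C, D, hsum, ⟨h, hC, hD⟩, horth⟩
    exact FilterNormalForm.mapHasSupport_of_normal_form hk hm hA hX hY hsum h hC hD horth
  · exact FilterNormalForm.exists_normal_form_of_mapHasSupport hk hm hkm hA
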